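/- Let $A$ be a well-ordered set, of order type the ordinal $o$, with a formal inverse set $A^{-1}$. A transfinite word is a function $w:S\to A\cup A^{-1}$ from a totally ordered set $S$ such that $w^{-1}(l)$ is finite for every letter $l$; words $w:S\to A\cup A^{-1}$ and $w':S'\to A\cup A^{-1}$ are identified if $w=w'\circ\phi$ for an order isomorphism $\phi:S\to S'$. A cancellation of $w$ is a subset $T\subseteq S$ with an involution $*:T\to T$ such that for all $t\in T$: $[t,t^*]_S=[t,t^*]_T$, $([t,t^*]_T)^*=[t,t^*]_T$ and $w(t^*)=w(t)^{-1}$; the word $w|_{S\setminus T}$ is then said to arise from $w$. A word is reduced if its only cancellation is the empty one. The big free group $\mathrm{BF}(o)$ is the set of words modulo the equivalence relation generated by "arises from", with the product induced by concatenation and the inverse induced by reversing the order and inverting every letter. Let $\Lambda=\mathbb Z^o=\prod_{a\in A}\mathbb Z$ with the lexicographic order: $s<t$ if $s_a<t_a$ at the first coordinate $a$ where $s$ and $t$ differ. A $\Lambda$-metric on $X$ is a function $d:X\times X\to\Lambda$ satisfying the usual axioms of a metric. A segment with endpoints $x,y$ is the image of a map $\alpha:[p,q]_\Lambda\to X$ with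 $d(\alpha(t),\alpha(t'))=|t-t'|$, $\alpha(p)=x$, $\alpha(q)=y$. A $\Lambda$-tree is a $\Lambda$-metric space in which any two points are the endpoints of a segment, the union of two segments meeting only in a common endpoint is a segment, and the intersection of two segments with a common endpoint is a segment. Put $(x\cdot y)_v=\frac12(d(v,x)+d(v,y)-d(x,y))$; the space is $0$-hyperbolic if $(x\cdot y)_v\ge\min\{(x\cdot z)_v,(y\cdot z)_v\}$ for all $v,x,y,z$. A length function on a group $G$ is a function $L:G\to\Lambda$ such that $L(g)=0$ iff $g=1$, $L(g)=L(g^{-1})$, and $c(g,h)\ge\min\{c(g,k),c(h,k)\}$ for all $g,h,k$, where $c(g,h)=\frac12(L(g)+L(h)-L(g^{-1}h))$. (These inequalities are read in $\frac12\Lambda$.) For a length function $L$ on $G$, let $T(G)$ be the disjoint union of the intervals $[0,L(g)]_\Lambda$, $g\in G$, with $n\in[0,L(g)]$ and $n\in[0,L(h)]$ identified if $n\le c(g,h)$; write $\langle n,g\rangle$ for the class of $n\in[0,L(g)]$, and put $d(\langle n,g\rangle,\langle m,h\rangle)=n+m-2\min\{n,m,c(g,h)\}$. The group $G$ is mapped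 to $T(G)$ by $g\mapsto\langle L(g),g\rangle$ and acts on $T(G)$ by $h\cdot\langle n,g\rangle=\langle L(h)-n,h\rangle$ if $n\le c(g,h^{-1})$, and $h\cdot\langle n,g\rangle=\langle L(h)+n-2c(g,h^{-1}),hg\rangle$ otherwise. Then the following hold. 1. Every element $g$ of $\mathrm{BF}(o)$ is represented by exactly one reduced word (up to identification). Let $L(g)\in\mathbb Z^o$ have as its $a$-coordinate the number of occurrences of $a$ and $a^{-1}$ in that word. 2. $d(w,v)=L(w^{-1}v)$ is a $0$-hyperbolic $\mathbb Z^o$-metric on $\mathrm{BF}(o)$, and $(w\cdot v)_u\in\mathbb Z^o$ for all $u,v,w\in\mathrm{BF}(o)$. 3. $L$ is a length function, $T(\mathrm{BF}(o))$ is a $\mathbb Z^o$-tree, and $g\mapsto\langle L(g),g\rangle$ is an isometric embedding of $\mathrm{BF}(o)$ into it. 4. $h\cdot\langle n,g\rangle$ is the point at distance $n$ from (the image of) $h$ on the segment between $h$ and $hg$. The action of $\mathrm{BF}(o)$ on $T(\mathrm{BF}(o))$ is by isometries, it is free (if $h\cdot x=x$ for some point $x$ then $h=1$), and it is without inversions (if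 $h^2$ fixes a point then so does $h$). -/

import Mathlib

universe u v w

namespace BigFree

/-! ## Transfinite words -/

/-- The set `A ∪ A⁻¹` of letters: `(a, true)` is `a` and `(a, false)` is the formal inverse of `a`. -/
abbrev Letter (A : Type u) : Type u := A × Bool

/-- The formal inverse of a letter. -/
def Letter.inv {A : Type u} (l : Letter A) : Letter A := (l.1, !l.2)

theorem Letter.inv_inv {A : Type u} (l : Letter A) : l.inv.inv = l := by simp [Letter.inv]

/-- A transfinite word over `A`: a function from a totally ordered set to `A ∪ A⁻¹`
taking each value only finitely often. -/
structure Word (A : Type u) : Type (u + 1) where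
  /-- the totally ordered set of positions -/
  S : Type u
  [ord : LinearOrder S]
  /-- the letter at a position -/
  letter : S → Letter A
  finite_fiber : ∀ l : Letter A, (letter ⁻¹' {l}).Finite

attribute [instance] Word.ord

namespace Word

variable {A : Type u}

/-- Two words are identified if there is an order isomorphism of their position sets
which preserves letters. -/
def Iso (w v : Word A) : Prop := ∃ e : w.S ≃o v.S, ∀ s, v.letter (e s) = w.letter s

/-- `star`, restricted to `T`, is a cancellation of `w` (values of `star` outside `T` are
irrelevant): an involution of `T` which is complete, noncrossing, and pairs inverse letters.
For `t, star t ∈ T`, completeness says that the interval `[t, star t]` in `w.S` lies in `T`. -/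
structure IsCancellation (w : Word A) (T : Set w.S) (star : w.S → w.S) : Prop where
  mapsTo : ∀ t ∈ T, star t ∈ T
  invol : ∀ t ∈ T, star (star t) = t
  complete : ∀ t ∈ T, Set.Icc t (star t) ⊆ T
  noncrossing : ∀ t ∈ T, star '' Set.Icc t (star t) = Set.Icc t (star t)
  inverse : ∀ t ∈ T, w.letter (star t) = (w.letter t).inv

/-- `v` arises from `w` by a cancellation: `v` is (up to isomorphism) the restriction of `w` to
the complement of the cancelled set `T`. -/
def Arises (w v : Word A) : Prop :=
  ∃ (T : Set w.S) (star : w.S → w.S), w.IsCancellation T star ∧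
    ∃ e : {s : w.S // s ∉ T} ≃o v.S, ∀ s, v.letter (e s) = w.letter s

/-- A word is reduced if it admits no nonempty cancellation. -/
def IsReduced (w : Word A) : Prop :=
  ∀ (T : Set w.S) (star : w.S → w.S), w.IsCancellation T star → T = ∅

/-- The number of occurrences of `a` and `a⁻¹` in `w`. -/
noncomputable def count (w : Word A) (a : A) : ℕ := Set.ncard {s : w.S | (w.letter s).1 = a}

/-- The empty word. -/
@[reducible] def empty (A : Type u) : Word A where
  S := PEmpty.{u + 1}
  letter s := s.elim
  finite_fiber _ := Set.toFinite _

/-- Concatenation of words. -/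
@[reducible] def append (w v : Word A) : Word A where
  S := w.S ⊕ₗ v.S
  letter s := Sum.elim w.letter v.letter (ofLex s)
  finite_fiber l := by
    refine (((w.finite_fiber l).image (fun s => toLex (Sum.inl s))).union
      ((v.finite_fiber l).image (fun s => toLex (Sum.inr s)))).subset ?_
    intro s hs
    rcases h : ofLex s with x | x
    · left
      refine ⟨x, ?_, h.symm⟩
      simpa [h] using hs
    · right
      refine ⟨x, ?_, h.symm⟩
      simpa [h] using hs

/-- The inverse word: the order is reversed and every letter is inverted. -/
@[reducible] def inverse (w : Word A) : Word A where
  S := w.Sᵒᵈ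
  letter s := (w.letter (OrderDual.ofDual s)).inv
  finite_fiber l := by
    refine ((w.finite_fiber l.inv).image OrderDual.toDual).subset ?_
    intro s hs
    refine ⟨OrderDual.ofDual s, ?_, rfl⟩
    have h : (w.letter (OrderDual.ofDual s)).inv = l := hs
    simp [← h, Letter.inv]

theorem isCancellation_empty (w : Word A) : w.IsCancellation ∅ id := by
  constructor <;> simp

theorem Arises.of_iso {w v : Word A} (h : w.Iso v) : Arises w v := by
  obtain ⟨e, he⟩ := h
  refine ⟨∅, id, w.isCancellation_empty, ?_⟩
  refine ⟨⟨⟨fun s => e s.1, fun s => ⟨e.symm s, fun h => h⟩, ?_, ?_⟩, ?_⟩, ?_⟩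
  · intro s; exact Subtype.ext (e.symm_apply_apply s.1)
  · intro s; exact e.apply_symm_apply s
  · intro s t; exact e.le_iff_le
  · intro s; exact he s.1

theorem Arises.append_right {w v : Word A} (h : Arises w v) (x : Word A) :
    Arises (w.append x) (v.append x) := by
  obtain ⟨T, star, hc, e, he⟩ := h
  let i : w.S → w.S ⊕ₗ x.S := fun s => toLex (Sum.inl s)
  have hi : Function.Injective i := fun a b h => Sum.inl_injective h
  let star' : w.S ⊕ₗ x.S → w.S ⊕ₗ x.S := fun s => toLex (Sum.map star id (ofLex s))
  have hstar : ∀ s, star' (i s) = i (star s) := fun s => rfl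
  have key : ∀ t t' : w.S, Set.Icc (i t) (i t') = i '' Set.Icc t t' := by
    intro t t'
    ext s
    induction s using Lex.rec with | _ s
    rcases s with s | s <;> simp [i]
  refine ⟨i '' T, star', ?_, ?_⟩
  · constructor
    · rintro _ ⟨t, ht, rfl⟩
      exact ⟨star t, hc.mapsTo t ht, rfl⟩
    · rintro _ ⟨t, ht, rfl⟩
      rw [hstar, hstar, hc.invol t ht]
    · rintro _ ⟨t, ht, rfl⟩
      rw [hstar, key]
      exact Set.image_mono (hc.complete t ht)
    · rintro _ ⟨t, ht, rfl⟩
      rw [hstar, key]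
      conv_rhs => rw [← hc.noncrossing t ht]
      rw [Set.image_image, Set.image_image]
      rfl
    · rintro _ ⟨t, ht, rfl⟩
      exact hc.inverse t ht
  · let f : v.S ⊕ₗ x.S → {s : w.S ⊕ₗ x.S // s ∉ i '' T} := fun s =>
      match s with
      | Sum.inl a => ⟨i (e.symm a).1, fun h => (e.symm a).2 ((hi.mem_set_image).1 h)⟩
      | Sum.inr b => ⟨toLex (Sum.inr b), by simp [i]⟩
    have hf : StrictMono f := by
      rintro (a | a) (b | b) h
      · exact Sum.Lex.inl_lt_inl_iff.2 (e.symm.strictMono (Sum.Lex.inl_lt_inl_iff.1 h))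
      · exact Sum.Lex.inl_lt_inr _ _
      · exact (Sum.Lex.not_inr_lt_inl h).elim
      · exact Sum.Lex.inr_lt_inr_iff.2 (Sum.Lex.inr_lt_inr_iff.1 h)
    have hs : Function.Surjective f := by
      rintro ⟨a | b, h⟩
      · refine ⟨Sum.inl (e ⟨a, fun h' => h ⟨a, h', rfl⟩⟩), Subtype.ext ?_⟩
        change i (e.symm (e ⟨a, _⟩)).1 = _
        rw [e.symm_apply_apply]; rfl
      · exact ⟨Sum.inr b, rfl⟩
    let g := hf.orderIsoOfSurjective f hs
    refine ⟨g.symm, fun s => ?_⟩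
    obtain ⟨t, rfl⟩ := g.surjective s
    rw [g.symm_apply_apply]
    rcases t with a | b
    · have := he (e.symm a)
      rw [e.apply_symm_apply] at this
      exact this
    · rfl

theorem Iso.symm {w v : Word A} (h : w.Iso v) : v.Iso w := by
  obtain ⟨e, he⟩ := h
  exact ⟨e.symm, fun s => by rw [← he, e.apply_symm_apply]⟩

theorem Arises.inverse {w v : Word A} (h : Arises w v) : Arises w.inverse v.inverse := by
  obtain ⟨T, star, hc, e, he⟩ := h
  have key : ∀ t ∈ T, (Set.Icc (OrderDual.toDual t) (OrderDual.toDual (star t)) : Set w.Sᵒᵈ)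
      = (OrderDual.ofDual ⁻¹' Set.Icc (star t) (star (star t)) : Set w.Sᵒᵈ) := by
    intro t ht
    rw [hc.invol t ht]
    ext s
    simp only [Set.mem_Icc, Set.mem_preimage]
    exact and_comm
  refine ⟨OrderDual.ofDual ⁻¹' T, fun s => OrderDual.toDual (star (OrderDual.ofDual s)), ?_, ?_⟩
  · constructor
    · intro t ht; exact hc.mapsTo _ ht
    · intro t ht; exact hc.invol _ ht
    · intro t ht
      exact (key _ ht).trans_subset fun s hs => hc.complete _ (hc.mapsTo _ ht) hs
    · intro t ht
      have h1 := key _ ht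
      have h2 := hc.noncrossing _ (hc.mapsTo _ ht)
      refine (congrArg _ h1).trans (Eq.trans ?_ h1.symm)
      exact h2
    · intro t ht
      exact congrArg Letter.inv (hc.inverse _ ht)
  · exact ⟨⟨⟨fun s => OrderDual.toDual (e ⟨OrderDual.ofDual s.1, s.2⟩),
      fun s => ⟨OrderDual.toDual (e.symm (OrderDual.ofDual s)).1, (e.symm (OrderDual.ofDual s)).2⟩,
      fun s => Subtype.ext (congrArg Subtype.val (e.symm_apply_apply ⟨OrderDual.ofDual s.1, s.2⟩)),
      fun s => e.apply_symm_apply (OrderDual.ofDual s)⟩,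
      fun {a b} => e.le_iff_le (x := ⟨OrderDual.ofDual b.1, b.2⟩) (y := ⟨OrderDual.ofDual a.1, a.2⟩)⟩,
      fun s => congrArg Letter.inv (he ⟨OrderDual.ofDual s.1, s.2⟩)⟩

theorem inverse_append_iso (w v : Word A) :
    (w.append v).inverse.Iso (v.inverse.append w.inverse) := by
  refine ⟨OrderIso.sumLexDualAntidistrib w.S v.S, ?_⟩
  rintro (s | s) <;> rfl

theorem inverse_inverse_iso (w : Word A) : w.inverse.inverse.Iso w :=
  ⟨(OrderIso.dualDual w.S).symm, fun _ => (Letter.inv_inv _).symm⟩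

theorem append_assoc_iso (w v x : Word A) :
    ((w.append v).append x).Iso (w.append (v.append x)) := by
  refine ⟨OrderIso.sumLexAssoc w.S v.S x.S, ?_⟩
  rintro ((s | s) | s) <;> rfl

theorem append_empty_iso (w : Word A) : w.Iso (w.append (empty A)) := by
  let f : w.S → w.S ⊕ₗ (empty A).S := fun s => toLex (Sum.inl s)
  have hf : StrictMono f := fun a b h => Sum.Lex.inl_lt_inl_iff.2 h
  have hs : Function.Surjective f := by
    rintro (s | s)
    · exact ⟨s, rfl⟩
    · exact s.elim
  exact ⟨hf.orderIsoOfSurjective f hs, fun s => rfl⟩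

theorem append_inverse_arises (w : Word A) : Arises (w.append w.inverse) (empty A) := by
  let star : w.S ⊕ₗ w.Sᵒᵈ → w.S ⊕ₗ w.Sᵒᵈ := fun s =>
    match s with
    | Sum.inl a => toLex (Sum.inr (OrderDual.toDual a))
    | Sum.inr b => toLex (Sum.inl (OrderDual.ofDual b))
  have hinv : ∀ s, star (star s) = s := by rintro (s | s) <;> rfl
  have hle : ∀ s t, s ≤ t → star t ≤ star s := by
    rintro (s | s) (t | t) h
    · exact Sum.Lex.inr_le_inr_iff.2
        (OrderDual.toDual_le_toDual.2 (Sum.Lex.inl_le_inl_iff.1 h))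
    · exact Sum.Lex.inl_le_inr _ _
    · exact (Sum.Lex.not_inr_le_inl h).elim
    · exact Sum.Lex.inl_le_inl_iff.2
        (OrderDual.ofDual_le_ofDual.2 (Sum.Lex.inr_le_inr_iff.1 h))
  refine ⟨Set.univ, star, ⟨fun _ _ => trivial, fun t _ => hinv t, fun _ _ _ _ => trivial, ?_, ?_⟩,
    ?_⟩
  · have hsub : ∀ t, ∀ s ∈ Set.Icc t (star t), star s ∈ Set.Icc t (star t) := by
      intro t s hs
      exact ⟨by simpa [hinv] using hle _ _ hs.2, hle _ _ hs.1⟩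
    intro t _
    apply Set.Subset.antisymm
    · rintro _ ⟨s, hs, rfl⟩
      exact hsub t s hs
    · intro s hs
      exact ⟨star s, hsub t s hs, hinv s⟩
  · rintro (t | t) _
    · rfl
    · exact (Letter.inv_inv _).symm
  · have : IsEmpty {s : w.S ⊕ₗ w.Sᵒᵈ // s ∉ Set.univ} := ⟨fun s => s.2 trivial⟩
    exact ⟨⟨⟨fun s => (this.false s).elim, fun s => s.elim, fun s => (this.false s).elim,
      fun s => s.elim⟩, fun {s} => (this.false s).elim⟩, fun s => (this.false s).elim⟩

/-- The equivalence relation on words generated by cancellation. -/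
def setoid (A : Type u) : Setoid (Word A) := Relation.EqvGen.setoid Arises

theorem eqv_append_right {w v : Word A} (h : Relation.EqvGen Arises w v) (x : Word A) :
    Relation.EqvGen Arises (w.append x) (v.append x) := by
  induction h with
  | rel _ _ h => exact .rel _ _ (h.append_right x)
  | refl _ => exact .refl _
  | symm _ _ _ ih => exact .symm _ _ ih
  | trans _ _ _ _ _ ih1 ih2 => exact .trans _ _ _ ih1 ih2

theorem eqv_inverse {w v : Word A} (h : Relation.EqvGen Arises w v) :
    Relation.EqvGen Arises w.inverse v.inverse := by
  induction h with
  | rel _ _ h => exact .rel _ _ h.inverse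
  | refl _ => exact .refl _
  | symm _ _ _ ih => exact .symm _ _ ih
  | trans _ _ _ _ _ ih1 ih2 => exact .trans _ _ _ ih1 ih2

theorem eqv_of_iso {w v : Word A} (h : w.Iso v) : Relation.EqvGen Arises w v :=
  .rel _ _ (.of_iso h)

theorem eqv_of_inverse {w v : Word A} (h : Relation.EqvGen Arises w.inverse v.inverse) :
    Relation.EqvGen Arises w v :=
  .trans _ _ _ (eqv_of_iso w.inverse_inverse_iso.symm)
    (.trans _ _ _ (eqv_inverse h) (eqv_of_iso v.inverse_inverse_iso))

theorem eqv_append_left (x : Word A) {w v : Word A} (h : Relation.EqvGen Arises w v) :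
    Relation.EqvGen Arises (x.append w) (x.append v) :=
  eqv_of_inverse (.trans _ _ _ (eqv_of_iso (inverse_append_iso x w))
    (.trans _ _ _ (eqv_append_right (eqv_inverse h) x.inverse)
      (eqv_of_iso (inverse_append_iso x v).symm)))

end Word

/-! ## The big free group -/

/-- The big free group on the alphabet `A`: transfinite words modulo cancellation. -/
def BF (A : Type u) : Type (u + 1) := Quotient (Word.setoid A)

namespace BF

variable {A : Type u}

/-- The element of the big free group represented by a word. -/
def mk (w : Word A) : BF A := Quotient.mk (Word.setoid A) w

/-- The group structure: the product is induced by concatenation, the unit is the empty word, and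
inverses are induced by reversing a word and inverting its letters. -/
instance : Group (BF A) :=
  letI : Mul (BF A) := ⟨Quotient.map₂ Word.append fun _ _ h _ _ h' =>
    .trans _ _ _ (Word.eqv_append_right h _) (Word.eqv_append_left _ h')⟩
  letI : One (BF A) := ⟨mk (Word.empty A)⟩
  letI : Inv (BF A) := ⟨Quotient.map Word.inverse fun _ _ h => Word.eqv_inverse h⟩
  Group.ofRightAxioms
    (by
      rintro ⟨a⟩ ⟨b⟩ ⟨c⟩
      exact Quotient.sound (Word.eqv_of_iso (Word.append_assoc_iso a b c)))
    (by
      rintro ⟨a⟩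
      exact Quotient.sound (Word.eqv_of_iso (Word.append_empty_iso a).symm))
    (by
      rintro ⟨a⟩
      exact Quotient.sound (.rel _ _ (Word.append_inverse_arises a)))

theorem mk_mul (w v : Word A) : mk w * mk v = mk (w.append v) := rfl

theorem mk_inv (w : Word A) : (mk w)⁻¹ = mk w.inverse := rfl

theorem mk_empty : mk (Word.empty A) = 1 := rfl

open Classical in
/-- A reduced word representing `g` (every `g` has one, unique up to
isomorphism). -/
noncomputable def reducedWord (g : BF A) : Word A :=
  if h : ∃ w : Word A, w.IsReduced ∧ mk w = g then h.choose else Word.empty A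

/-- The length of `g`: in coordinate `a`, the number of occurrences of `a` and `a⁻¹` in the reduced
word of `g`. The group `ℤ^A` carries the lexicographic order. -/
noncomputable def length (g : BF A) : Lex (A → ℤ) :=
  toLex fun a => ((reducedWord g).count a : ℤ)

end BF

/-! ## Metric spaces over an ordered abelian group -/

section Metric

variable {Λ : Type v} [AddCommGroup Λ] [LinearOrder Λ] {X : Type w}

/-- `d` is a `Λ`-metric. -/
structure IsLambdaMetric (d : X → X → Λ) : Prop where
  nonneg : ∀ x y, 0 ≤ d x y
  eq_zero_iff : ∀ x y, d x y = 0 ↔ x = y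
  symm : ∀ x y, d x y = d y x
  triangle : ∀ x y z, d x y ≤ d x z + d z y

/-- `s` is a segment with endpoints `x` and `y`: the image of an isometry from an interval
`[a, b]` of `Λ`, where `Λ` has the metric `|t - t'|`. -/
def IsSegmentBetween (d : X → X → Λ) (x y : X) (s : Set X) : Prop :=
  ∃ (a b : Λ) (α : Λ → X), a ≤ b ∧
    (∀ t ∈ Set.Icc a b, ∀ t' ∈ Set.Icc a b, d (α t) (α t') = |t - t'|) ∧
    α a = x ∧ α b = y ∧ s = α '' Set.Icc a b

/-- `s` is a segment. -/
def IsSegment (d : X → X → Λ) (s : Set X) : Prop := ∃ x y, IsSegmentBetween d x y s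

/-- `X` with `d` is a `Λ`-tree. -/
structure IsLambdaTree (d : X → X → Λ) : Prop where
  metric : IsLambdaMetric d
  geodesic : ∀ x y, ∃ s, IsSegmentBetween d x y s
  union_segment : ∀ (x y z : X) (s t : Set X), IsSegmentBetween d x y s →
    IsSegmentBetween d x z t → s ∩ t = {x} → IsSegment d (s ∪ t)
  inter_segment : ∀ (x y z : X) (s t : Set X), IsSegmentBetween d x y s →
    IsSegmentBetween d x z t → IsSegment d (s ∩ t)

/-- Twice the Gromov product `(x · y)_v`. -/
def twiceGromov (d : X → X → Λ) (v x y : X) : Λ := d v x + d v y - d x y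

/-- The Gromov product `(x · y)_v` lies in `Λ` for all `v, x, y`. -/
def GromovIntegral (d : X → X → Λ) : Prop := ∀ v x y, ∃ c : Λ, c + c = twiceGromov d v x y

/-- `δ`-hyperbolicity: `x · y ≥ min (x · z) (y · z) - δ` with respect to every basepoint, written
after multiplication by two. -/
def IsHyperbolic (d : X → X → Λ) (δ : Λ) : Prop :=
  ∀ v x y z, min (twiceGromov d v x z) (twiceGromov d v y z) - (δ + δ) ≤ twiceGromov d v x y

end Metric

/-! ## Length functions and the tree of a length function -/

section Tree

variable {G : Type w} [Group G] {Λ : Type v} [AddCommGroup Λ] [LinearOrder Λ]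

/-- Twice `c(g, h) = (L g + L h - L (g⁻¹ h)) / 2`. -/
def twiceC (L : G → Λ) (g h : G) : Λ := L g + L h - L (g⁻¹ * h)

/-- `L` is a length function; the third condition is
`c(g, h) ≥ min (c(g, k)) (c(h, k))`, multiplied by two. -/
structure IsLengthFunction (L : G → Λ) : Prop where
  eq_zero_iff : ∀ g, L g = 0 ↔ g = 1
  inv : ∀ g, L g = L g⁻¹
  hyp : ∀ g h k, min (twiceC L g k) (twiceC L h k) ≤ twiceC L g h

variable [IsOrderedAddMonoid Λ] {L : G → Λ}

namespace IsLengthFunction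

theorem map_one (hL : IsLengthFunction L) : L 1 = 0 := (hL.eq_zero_iff 1).2 rfl

theorem twiceC_symm (hL : IsLengthFunction L) (g h : G) : twiceC L g h = twiceC L h g := by
  have := hL.inv (g⁻¹ * h)
  simp only [mul_inv_rev, inv_inv] at this
  simp only [twiceC, this]
  abel

theorem twiceC_self (hL : IsLengthFunction L) (g : G) : twiceC L g g = L g + L g := by
  simp [twiceC, hL.map_one]

theorem twiceC_nonneg (hL : IsLengthFunction L) (g h : G) : 0 ≤ twiceC L g h := by
  have h1 := hL.hyp g h 1
  have h2 : ∀ g, twiceC L g 1 = 0 := fun g => by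
    have := hL.inv g
    simp [twiceC, hL.map_one, ← this]
  simpa [h2] using h1

theorem twiceC_le (hL : IsLengthFunction L) (g h : G) : twiceC L g h ≤ L g + L g := by
  have h1 := hL.hyp g g h
  rwa [min_self, hL.twiceC_self] at h1

theorem nonneg (hL : IsLengthFunction L) (g : G) : 0 ≤ L g := by
  have h1 := hL.twiceC_nonneg g g
  rw [hL.twiceC_self] at h1
  by_contra h
  exact absurd (add_neg (not_le.1 h) (not_le.1 h)) (not_lt.2 h1)

end IsLengthFunction

/-- The disjoint union of the intervals `[0, L g]` of `Λ`, for `g` in `G`. -/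
structure TreePre (L : G → Λ) where
  /-- the point of the interval -/
  n : Λ
  /-- the index of the interval -/
  g : G
  nonneg : 0 ≤ n
  le : n ≤ L g

/-- The identification: `n ∈ [0, L g]` and `n ∈ [0, L h]` are identified if `n ≤ c(g, h)`. -/
def treeSetoid (hL : IsLengthFunction L) : Setoid (TreePre L) where
  r p q := p.n = q.n ∧ p.n + p.n ≤ twiceC L p.g q.g
  iseqv := {
    refl := fun p => ⟨rfl, by rw [hL.twiceC_self]; exact add_le_add p.le p.le⟩
    symm := fun {p q} h => ⟨h.1.symm, by rw [hL.twiceC_symm, ← h.1]; exact h.2⟩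
    trans := fun {p q r} h h' => ⟨h.1.trans h'.1, by
      refine le_trans (le_min h.2 ?_) (hL.hyp p.g r.g q.g)
      rw [hL.twiceC_symm, h.1]; exact h'.2⟩ }

/-- The set `T(G)`, the quotient of the disjoint union of the intervals `[0, L g]`. -/
def Tree (hL : IsLengthFunction L) : Type (max v w) := Quotient (treeSetoid hL)

namespace Tree

/-- The point `⟨n, g⟩` of `T(G)`. -/
def point (hL : IsLengthFunction L) (n : Λ) (g : G) (h0 : 0 ≤ n) (h1 : n ≤ L g) : Tree hL :=
  Quotient.mk (treeSetoid hL) ⟨n, g, h0, h1⟩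

/-- The embedding of `G` in `T(G)`, sending `g` to `⟨L g, g⟩`. -/
def ofGroup (hL : IsLengthFunction L) (g : G) : Tree hL :=
  point hL (L g) g (hL.nonneg g) le_rfl

/-- The formula `n + m - 2 min {n, m, c(g, h)}`. -/
def preDist (L : G → Λ) (p q : TreePre L) : Λ :=
  p.n + q.n - min (min (p.n + p.n) (q.n + q.n)) (twiceC L p.g q.g)

theorem preDist_symm (hL : IsLengthFunction L) (p q : TreePre L) :
    preDist L p q = preDist L q p := by
  simp only [preDist, hL.twiceC_symm p.g q.g, min_comm (p.n + p.n), add_comm p.n q.n]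

theorem preDist_congr_left (hL : IsLengthFunction L) {p p' : TreePre L}
    (h : (treeSetoid hL).r p p') (q : TreePre L) : preDist L p q = preDist L p' q := by
  obtain ⟨h1, h2⟩ := h
  have a := hL.hyp p.g q.g p'.g
  have b := hL.hyp p'.g q.g p.g
  rw [hL.twiceC_symm q.g p'.g] at a
  rw [hL.twiceC_symm p'.g p.g, hL.twiceC_symm q.g p.g] at b
  simp only [preDist, ← h1]
  congr 1
  grind

/-- The metric `d(⟨n, g⟩, ⟨m, h⟩) = n + m - 2 min {n, m, c(g, h)}` of `T(G)`. -/
def dist (hL : IsLengthFunction L) : Tree hL → Tree hL → Λ :=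
  Quotient.lift₂ (preDist L) fun p q p' q' h h' => by
    rw [preDist_congr_left hL h, preDist_symm hL, preDist_congr_left hL h', preDist_symm hL]

/-- The action of `h` on `⟨n, g⟩`: it is `⟨L h - n, h⟩` if `n ≤ c(g, h⁻¹)` and
`⟨L h + n - 2 c(g, h⁻¹), h g⟩` otherwise. -/
def preSMul (hL : IsLengthFunction L) (h : G) (p : TreePre L) : TreePre L :=
  if hp : p.n + p.n ≤ twiceC L p.g h⁻¹ then
    { n := L h - p.n
      g := h
      nonneg := by
        have h1 := hL.twiceC_le h⁻¹ p.g
        rw [hL.twiceC_symm, ← hL.inv] at h1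
        grind
      le := by
        have := p.nonneg
        grind }
  else
    { n := L h + p.n - twiceC L p.g h⁻¹
      g := h * p.g
      nonneg := by
        have h1 := hL.twiceC_le h⁻¹ p.g
        rw [hL.twiceC_symm, ← hL.inv] at h1
        grind
      le := by
        have h1 := hL.inv (h * p.g)
        have h2 := hL.inv h
        have h3 := p.le
        simp only [twiceC, ← mul_inv_rev, ← h1, ← h2]
        grind }

theorem preDist_preSMul (hL : IsLengthFunction L) (h k : G) (p q q' : TreePre L)
    (hq : q.n = L k ∧ q.g = k) (hq' : q'.n = L (h⁻¹ * k) ∧ q'.g = h⁻¹ * k) :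
    preDist L (preSMul hL h p) q = preDist L p q' := by
  have e1 := hL.twiceC_le h⁻¹ (h⁻¹ * k)
  have e2 := hL.twiceC_le (h⁻¹ * k) h⁻¹
  have e3 := hL.twiceC_le p.g (h⁻¹ * k)
  have e4 := hL.twiceC_le (h⁻¹ * k) p.g
  have e5 := hL.twiceC_le p.g h⁻¹
  have e6 := hL.twiceC_le h⁻¹ p.g
  have a := hL.hyp p.g (h⁻¹ * k) h⁻¹
  have b := hL.hyp p.g h⁻¹ (h⁻¹ * k)
  have c := hL.hyp h⁻¹ (h⁻¹ * k) p.g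
  rw [hL.twiceC_symm (h⁻¹ * k) h⁻¹] at a e2
  rw [hL.twiceC_symm (h⁻¹ * k) p.g] at c e4
  rw [hL.twiceC_symm h⁻¹ p.g] at c e6
  have d1 := hL.twiceC_le k (h * p.g)
  have d2 := hL.twiceC_le k h
  rw [hL.twiceC_symm] at d1 d2
  have i1 := hL.inv h
  have i2 := hL.inv (h * p.g)
  have l0 := p.nonneg
  have l1 := p.le
  have x1 : (h * p.g)⁻¹ * k = p.g⁻¹ * (h⁻¹ * k) := by group
  unfold preSMul
  split_ifs with hp
  · simp only [preDist, hq.1, hq.2, hq'.1, hq'.2]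
    simp only [twiceC, ← mul_inv_rev, inv_inv, mul_inv_cancel_left, ← i1, ← i2, x1] at *
    grind
  · simp only [preDist, hq.1, hq.2, hq'.1, hq'.2]
    simp only [twiceC, ← mul_inv_rev, inv_inv, mul_inv_cancel_left, ← i1, ← i2, x1] at *
    grind

/-- A point of `T(G)` is determined by its distances to the points of `G`. -/
theorem rel_of_preDist_eq (hL : IsLengthFunction L) (f : G → TreePre L)
    (hf : ∀ k, (f k).n = L k ∧ (f k).g = k) (p q : TreePre L)
    (h : ∀ k, preDist L p (f k) = preDist L q (f k)) : (treeSetoid hL).r p q := by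
  have h0 := h 1
  have h1 := h p.g
  have a := hL.twiceC_le q.g p.g
  rw [hL.twiceC_symm] at a
  have c1 : ∀ g, twiceC L g 1 = 0 := fun g => by
    have := hL.inv g
    simp [twiceC, hL.map_one, ← this]
  have b1 := p.nonneg
  have b2 := q.nonneg
  have b3 := p.le
  have b4 := q.le
  simp only [preDist, (hf _).1, (hf _).2, c1, hL.map_one, hL.twiceC_self,
    hL.twiceC_symm q.g p.g] at h0 h1
  have e : p.n = q.n := by grind
  refine ⟨e, ?_⟩
  rw [← e] at h1
  grind

/-- The representative `(L g, g)` of the point `⟨L g, g⟩`. -/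
def preOfGroup (hL : IsLengthFunction L) (g : G) : TreePre L where
  n := L g
  g := g
  nonneg := hL.nonneg g
  le := le_rfl

theorem dist_ext (hL : IsLengthFunction L) {x y : Tree hL}
    (h : ∀ k, dist hL x (ofGroup hL k) = dist hL y (ofGroup hL k)) : x = y := by
  induction x using Quotient.inductionOn with | _ p
  induction y using Quotient.inductionOn with | _ q
  exact Quotient.sound (rel_of_preDist_eq hL (preOfGroup hL) (fun _ => ⟨rfl, rfl⟩) p q h)

/-- The action of an element of `G` on `T(G)`. -/
def smul (hL : IsLengthFunction L) (h : G) : Tree hL → Tree hL :=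
  Quotient.map (preSMul hL h) fun p p' hp => by
    refine rel_of_preDist_eq hL (preOfGroup hL) (fun _ => ⟨rfl, rfl⟩) _ _ fun k => ?_
    rw [preDist_preSMul hL h k p _ (preOfGroup hL (h⁻¹ * k)) ⟨rfl, rfl⟩ ⟨rfl, rfl⟩,
      preDist_preSMul hL h k p' _ (preOfGroup hL (h⁻¹ * k)) ⟨rfl, rfl⟩ ⟨rfl, rfl⟩,
      preDist_congr_left hL hp]

theorem dist_smul (hL : IsLengthFunction L) (h k : G) (x : Tree hL) :
    dist hL (smul hL h x) (ofGroup hL k) = dist hL x (ofGroup hL (h⁻¹ * k)) := by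
  induction x using Quotient.inductionOn with | _ p
  exact preDist_preSMul hL h k p _ _ ⟨rfl, rfl⟩ ⟨rfl, rfl⟩

/-- The action of `G` on `T(G)`. -/
instance (hL : IsLengthFunction L) : MulAction G (Tree hL) where
  smul := smul hL
  one_smul x := dist_ext hL fun k => by
    change dist hL (smul hL 1 x) _ = _
    rw [dist_smul, inv_one, one_mul]
  mul_smul g h x := dist_ext hL fun k => by
    change dist hL (smul hL (g * h) x) _ = dist hL (smul hL g (smul hL h x)) _
    rw [dist_smul, dist_smul, dist_smul, mul_inv_rev, mul_assoc]

end Tree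

end Tree

end BigFree

/-! Two arguments meet in the inequality `c(g, h) ≥ min (c(g, k)) (c(h, k))`, one about words and
one about ordered groups.

Words: letting only the letters of a finite set `F` and their inverses survive maps a word to a free
group, and this projection is invariant under cancellation (`Word.Arises.proj_eq`). Conversely, a
word with all projections trivial cancels completely: its finite projections have noncrossing
pairings, every position has only finitely many possible partners, and an ultrafilter limit of the
pairings is a cancellation (`Word.exists_isCancellation_univ`). Zorn's lemma provides reduced
representatives. If `w` and `v` are reduced, every pair of a cancellation of `w⁻¹ v` straddles the
junction, so what cancels is a common initial segment of `w` and `v`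
(`Word.IsCancellation.restrict_iso`). If `w` and `v` represent the same element, this segment is
everything, which is uniqueness. In general, after maximal cancellation, `c(w, v)` is the length of
the common initial segment; hence it is integral. Initial segments of one reduced word are nested,
which gives the inequality (`BF.isLengthFunction_length`). The well-order of `A` serves to make the
lexicographic order of `ℤ^A` linear.

Trees: in `T(G)` the inequality says that the heights at which points branch off form an
ultrametric, and this yields the triangle inequality and `0`-hyperbolicity. In a `0`-hyperbolic
space a segment is the set of all points between its endpoints, and the tree axioms follow once the
branch points exist, that is, once Gromov products lie in `Λ` (`isLambdaTree_of_isHyperbolic`).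

Action: points of `T(G)` lie between points of `G`, where the action is left translation, so it is
isometric. A fixed point of `h` forces `L (h * h) ≤ L h`. Cyclic reduction together with the absence
of `2`-torsion, inherited from free groups, then gives `h = 1`. -/

namespace BigFree

/-! ### Segments in `0`-hyperbolic spaces over an ordered abelian group. -/

section Hyperbolic

variable {Λ : Type v} [AddCommGroup Λ] [LinearOrder Λ] [IsOrderedAddMonoid Λ] {X : Type w}
  {d : X → X → Λ}

theorem IsHyperbolic.min_le (hd : IsHyperbolic d 0) (v x y z : X) :
    min (d v x + d v z - d x z) (d v y + d v z - d y z) ≤ d v x + d v y - d x y := by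
  simpa [twiceGromov] using hd v x y z

/-- The set of points between `x` and `y`. -/
def between (d : X → X → Λ) (x y : X) : Set X := {p | d x p + d p y = d x y}

/-- In a `0`-hyperbolic space, the distance of two points between `x` and `y` is the difference of
their distances to `x`. -/
theorem dist_eq_abs_of_between (hm : IsLambdaMetric d) (hh : IsHyperbolic d 0) {x y p q : X}
    (hp : p ∈ between d x y) (hq : q ∈ between d x y) : d p q = |d x p - d x q| := by
  have h1 := hh.min_le x p q y
  have h2 := hm.triangle x p q
  have h3 := hm.triangle x q p
  have h4 := hm.symm p q
  have hp' : d x p + d p y = d x y := hp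
  have hq' : d x q + d q y = d x y := hq
  rcases le_total (d x p) (d x q) with h | h
  · rw [abs_of_nonpos (sub_nonpos.2 h)]; grind
  · rw [abs_of_nonneg (sub_nonneg.2 h)]; grind

theorem eq_of_between (hm : IsLambdaMetric d) (hh : IsHyperbolic d 0) {x y p q : X}
    (hp : p ∈ between d x y) (hq : q ∈ between d x y) (h : d x p = d x q) : p = q := by
  rw [← hm.eq_zero_iff, dist_eq_abs_of_between hm hh hp hq, h, sub_self, abs_zero]

/-- Between any two points there are points at all intermediate distances. -/
def HasIntermediate (d : X → X → Λ) : Prop :=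
  ∀ x y r, 0 ≤ r → r ≤ d x y → ∃ p ∈ between d x y, d x p = r

/-- A point between `x` and `y` is determined by its distance to `x`, and the segment already
contains a point at each such distance. Segments are therefore unique, and the tree axioms become
statements about the sets `between`. -/
theorem IsSegmentBetween.eq_between (hm : IsLambdaMetric d) (hh : IsHyperbolic d 0) {x y : X}
    {s : Set X} (hs : IsSegmentBetween d x y s) : s = between d x y := by
  obtain ⟨a, b, α, hab, hα, rfl, rfl, rfl⟩ := hs
  have key : ∀ t ∈ Set.Icc a b, d (α a) (α t) = t - a ∧ α t ∈ between d (α a) (α b) := by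
    intro t ht
    have h1 := hα a ⟨le_rfl, hab⟩ t ht
    have h2 := hα t ht b ⟨hab, le_rfl⟩
    have h3 := hα a ⟨le_rfl, hab⟩ b ⟨hab, le_rfl⟩
    rw [abs_sub_comm, abs_of_nonneg (sub_nonneg.2 ht.1)] at h1
    rw [abs_sub_comm, abs_of_nonneg (sub_nonneg.2 ht.2)] at h2
    rw [abs_sub_comm, abs_of_nonneg (sub_nonneg.2 hab)] at h3
    refine ⟨h1, ?_⟩
    change _ + _ = _
    rw [h1, h2, h3]; abel
  apply Set.Subset.antisymm
  · rintro _ ⟨t, ht, rfl⟩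
    exact (key t ht).2
  · intro p hp
    have h0 := hm.nonneg (α a) p
    have h1 := hm.nonneg p (α b)
    have h2 := (key b ⟨hab, le_rfl⟩).1
    have hp' : d (α a) p + d p (α b) = d (α a) (α b) := hp
    have ht : a + d (α a) p ∈ Set.Icc a b := by constructor <;> grind
    refine ⟨_, ht, eq_of_between hm hh (key _ ht).2 hp ?_⟩
    rw [(key _ ht).1]; abel

theorem isSegmentBetween_between (hm : IsLambdaMetric d) (hh : IsHyperbolic d 0)
    (hi : HasIntermediate d) (x y : X) : IsSegmentBetween d x y (between d x y) := by
  classical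
  have hx : x ∈ between d x y := by
    change _ + _ = _
    rw [(hm.eq_zero_iff x x).2 rfl, zero_add]
  have hy : y ∈ between d x y := by
    change _ + _ = _
    rw [(hm.eq_zero_iff y y).2 rfl, add_zero]
  have h0 : (0 : Λ) ∈ Set.Icc 0 (d x y) := ⟨le_rfl, hm.nonneg x y⟩
  have h1 : d x y ∈ Set.Icc 0 (d x y) := ⟨hm.nonneg x y, le_rfl⟩
  have hc : ∀ r : Λ, ∃ p : X, r ∈ Set.Icc 0 (d x y) → p ∈ between d x y ∧ d x p = r := by
    intro r
    by_cases hr : r ∈ Set.Icc 0 (d x y)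
    · obtain ⟨p, hp⟩ := hi x y r hr.1 hr.2
      exact ⟨p, fun _ => hp⟩
    · exact ⟨x, fun h => absurd h hr⟩
  choose α hα using hc
  refine ⟨0, d x y, α, hm.nonneg x y, ?_, ?_, ?_, ?_⟩
  · intro t ht t' ht'
    rw [dist_eq_abs_of_between hm hh (hα t ht).1 (hα t' ht').1, (hα t ht).2, (hα t' ht').2]
  · exact eq_of_between hm hh (hα 0 h0).1 hx ((hα 0 h0).2.trans ((hm.eq_zero_iff x x).2 rfl).symm)
  · exact eq_of_between hm hh (hα _ h1).1 hy (hα _ h1).2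
  · apply Set.Subset.antisymm
    · intro p hp
      have hp' : d x p + d p y = d x y := hp
      have h2 := hm.nonneg p y
      have hr : d x p ∈ Set.Icc 0 (d x y) := ⟨hm.nonneg x p, by grind⟩
      exact ⟨_, hr, eq_of_between hm hh (hα _ hr).1 hp (hα _ hr).2⟩
    · rintro _ ⟨t, ht, rfl⟩
      exact (hα t ht).1

/-- A `0`-hyperbolic geodesic space with integral Gromov products is a tree. -/
theorem isLambdaTree_of_isHyperbolic (hm : IsLambdaMetric d) (hh : IsHyperbolic d 0)
    (hi : HasIntermediate d) (hg : GromovIntegral d) : IsLambdaTree d := by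
  have mem : ∀ {x y p : X}, p ∈ between d x y ↔ d x p + d p y = d x y := Iff.rfl
  -- The branch point of the tripod `x, y, z`: the point of `[x, y]` at distance `(y · z)_x` from
  -- `x`. Integrality makes this distance an element of `Λ`; hyperbolicity puts the point on `[x,
  -- z]` as well.
  have branch : ∀ x y z, ∃ q ∈ between d x y, q ∈ between d x z ∧
      d x q + d x q = d x y + d x z - d y z := by
    intro x y z
    obtain ⟨c, hc⟩ := hg x y z
    rw [twiceGromov] at hc
    have t1 := hm.triangle y z x
    have t2 := hm.triangle x z y
    rw [hm.symm y x] at t1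
    have t3 := hm.triangle x y z
    rw [hm.symm z y] at t3
    obtain ⟨q, hq, hq'⟩ := hi x y c (by grind) (by grind)
    refine ⟨q, hq, ?_, by rw [hq', hc]⟩
    have h1 := hh.min_le x q z y
    have h2 := hm.triangle x z q
    rw [hm.symm z y] at h1
    rw [mem] at hq ⊢
    grind
  refine ⟨hm, fun x y => ⟨_, isSegmentBetween_between hm hh hi x y⟩, ?_, ?_⟩
  · intro x y z s t hs ht hst
    rw [hs.eq_between hm hh, ht.eq_between hm hh] at hst ⊢
    obtain ⟨q, hq1, hq2, hq⟩ := branch x y z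
    -- The branch point lies on both segments, so it is `x`. Hence `(y · z)_x = 0`, so `x` is
    -- between `y` and `z` and the union is `[y, z]`.
    have hqx : q = x := by
      have : q ∈ ({x} : Set X) := hst ▸ ⟨hq1, hq2⟩
      exact this
    rw [hqx, (hm.eq_zero_iff x x).2 rfl, add_zero] at hq
    have e := hm.symm x y
    refine ⟨y, z, ?_⟩
    convert isSegmentBetween_between hm hh hi y z using 1
    ext p
    simp only [Set.mem_union, mem]
    have t1 := hm.triangle y z p
    have t2 := hm.triangle p z x
    have t3 := hm.triangle y p x
    have e1 := hm.symm x p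
    have e2 := hm.symm y p
    constructor
    · rintro (h | h) <;> grind
    · intro h
      have hx : x ∈ between d y z := by rw [mem]; grind
      have h4 := dist_eq_abs_of_between hm hh (p := p) h hx
      rcases le_total (d y p) (d y x) with h5 | h5
      · rw [abs_of_nonpos (sub_nonpos.2 h5)] at h4
        left; grind
      · rw [abs_of_nonneg (sub_nonneg.2 h5)] at h4
        right; grind
  · intro x y z s t hs ht
    rw [hs.eq_between hm hh, ht.eq_between hm hh]
    obtain ⟨q, hq1, hq2, hq⟩ := branch x y z
    -- The two segments share exactly the part up to the branch point.
    refine ⟨x, q, ?_⟩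
    convert isSegmentBetween_between hm hh hi x q using 1
    ext p
    simp only [Set.mem_inter_iff]
    constructor
    · rintro ⟨h1, h2⟩
      have h3 := hh.min_le x y z p
      have h4 := dist_eq_abs_of_between hm hh h1 hq1
      rw [hm.symm y p, hm.symm z p] at h3
      rw [mem] at *
      have : d x p ≤ d x q := by grind
      rw [abs_of_nonpos (sub_nonpos.2 this)] at h4
      grind
    · intro h
      have t1 := hm.triangle p y q
      have t2 := hm.triangle p z q
      have t3 := hm.triangle x y p
      have t4 := hm.triangle x z p
      rw [mem] at *
      constructor <;> grind

/-- The distance of `x` to a point between `u` and `v`. -/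
theorem dist_eq_max_of_between (hm : IsLambdaMetric d) (hh : IsHyperbolic d 0) {u v y : X}
    (hy : y ∈ between d u v) (x : X) :
    d x y = max (d x u + d y v) (d x v + d u y) - d u v := by
  -- The four-point condition for `x, y, u, v`: this inequality gives the upper bound, the two
  -- triangle inequalities the lower bound.
  have h1 := hh.min_le x u v y
  have t1 := hm.triangle x u y
  have t2 := hm.triangle x v y
  have h2 := hh.min_le x y u v
  have h3 := hh.min_le v x y u
  have e1 := hm.symm u y
  have e2 := hm.symm v y
  have e3 := hm.symm v x
  have e4 := hm.symm v u
  have hy' : d u y + d y v = d u v := hy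
  grind

end Hyperbolic

/-! ### The tree of a length function and the action on it. -/

section Tree

variable {G : Type w} [Group G] {Λ : Type v} [AddCommGroup Λ] [LinearOrder Λ] {L : G → Λ}

namespace Tree

/-- Twice the length of the common part of two points of `T(G)`, seen from the base point. -/
def preMeet (L : G → Λ) (p q : TreePre L) : Λ :=
  min (min (p.n + p.n) (q.n + q.n)) (twiceC L p.g q.g)

theorem preDist_eq (p q : TreePre L) : preDist L p q = p.n + q.n - preMeet L p q := rfl

theorem preMeet_le_left (p q : TreePre L) : preMeet L p q ≤ p.n + p.n :=
  (min_le_left _ _).trans (min_le_left _ _)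

theorem preMeet_le_right (p q : TreePre L) : preMeet L p q ≤ q.n + q.n :=
  (min_le_left _ _).trans (min_le_right _ _)

/-- The ultrametric inequality for heights of branching. It is `0`-hyperbolicity with respect to the
root, and the only form in which the axiom `hyp` enters the metric properties below. -/
theorem min_le_preMeet (hL : IsLengthFunction L) (p q r : TreePre L) :
    min (preMeet L p r) (preMeet L q r) ≤ preMeet L p q := by
  refine le_min (le_min ?_ ?_) ?_
  · exact (min_le_left _ _).trans (preMeet_le_left _ _)
  · exact (min_le_right _ _).trans (preMeet_le_left _ _)
  · exact (min_le_min (min_le_right _ _) (min_le_right _ _)).trans (hL.hyp p.g q.g r.g)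

theorem exists_add_self_eq_preMeet (hi : ∀ g h, ∃ c, c + c = twiceC L g h) (p q : TreePre L) :
    ∃ c, c + c = preMeet L p q := by
  rw [preMeet]
  rcases min_choice (min (p.n + p.n) (q.n + q.n)) (twiceC L p.g q.g) with h | h
  · rw [h]
    rcases min_choice (p.n + p.n) (q.n + q.n) with h | h <;> exact ⟨_, h.symm⟩
  · rw [h]
    exact hi _ _

variable [IsOrderedAddMonoid Λ]

theorem preMeet_symm (hL : IsLengthFunction L) (p q : TreePre L) :
    preMeet L p q = preMeet L q p := by
  simp only [preMeet, hL.twiceC_symm p.g q.g, min_comm (p.n + p.n)]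

theorem preMeet_nonneg (hL : IsLengthFunction L) (p q : TreePre L) : 0 ≤ preMeet L p q :=
  le_min (le_min (add_nonneg p.nonneg p.nonneg) (add_nonneg q.nonneg q.nonneg))
    (hL.twiceC_nonneg _ _)

theorem isLambdaMetric_dist (hL : IsLengthFunction L) : IsLambdaMetric (dist hL) where
  nonneg x y := by
    induction x using Quotient.inductionOn with | _ p
    induction y using Quotient.inductionOn with | _ q
    change 0 ≤ preDist L p q
    have h1 := preMeet_le_left p q
    have h2 := preMeet_le_right p q
    rw [preDist_eq]
    grind
  eq_zero_iff x y := by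
    induction x using Quotient.inductionOn with | _ p
    induction y using Quotient.inductionOn with | _ q
    change preDist L p q = 0 ↔ _
    refine Iff.trans ?_ (Quotient.eq (r := treeSetoid hL)).symm
    change _ ↔ p.n = q.n ∧ p.n + p.n ≤ twiceC L p.g q.g
    rw [preDist]
    grind
  symm x y := by
    induction x using Quotient.inductionOn with | _ p
    induction y using Quotient.inductionOn with | _ q
    exact preDist_symm hL p q
  triangle x y z := by
    induction x using Quotient.inductionOn with | _ p
    induction y using Quotient.inductionOn with | _ q
    induction z using Quotient.inductionOn with | _ r
    change preDist L p q ≤ preDist L p r + preDist L r q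
    have h1 := preMeet_le_right p r
    have h2 := preMeet_le_right q r
    have h3 := min_le_preMeet hL p q r
    rw [preDist_eq, preDist_eq, preDist_eq, preMeet_symm hL r q]
    grind

/-- Change of basepoint from the root to `v`: the heights drop out, leaving `min (m(p,r) + m(o,q))
(m(q,r) + m(o,p)) ≤ m(p,q) + m(o,r)` for `m = preMeet L`. This follows from the ultrametric
inequality for the triples among the four points. -/
theorem isHyperbolic_dist (hL : IsLengthFunction L) : IsHyperbolic (dist hL) 0 := by
  intro v x y z
  induction v using Quotient.inductionOn with | _ o
  induction x using Quotient.inductionOn with | _ p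
  induction y using Quotient.inductionOn with | _ q
  induction z using Quotient.inductionOn with | _ r
  change min (preDist L o p + preDist L o r - preDist L p r)
    (preDist L o q + preDist L o r - preDist L q r) - (0 + 0) ≤
      preDist L o p + preDist L o q - preDist L p q
  have h1 := min_le_preMeet hL o p q
  have h2 := min_le_preMeet hL o p r
  have h3 := min_le_preMeet hL o q p
  have h4 := min_le_preMeet hL o q r
  have h5 := min_le_preMeet hL o r p
  have h6 := min_le_preMeet hL o r q
  have h7 := min_le_preMeet hL p q o
  have h8 := min_le_preMeet hL p q r
  have h9 := min_le_preMeet hL p r o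
  have h10 := min_le_preMeet hL p r q
  have h11 := min_le_preMeet hL q r o
  have h12 := min_le_preMeet hL q r p
  simp only [preDist_eq, preMeet_symm hL p o, preMeet_symm hL q o, preMeet_symm hL r o,
    preMeet_symm hL q p, preMeet_symm hL r p, preMeet_symm hL r q] at *
  grind

theorem gromovIntegral_dist (hL : IsLengthFunction L) (hi : ∀ g h, ∃ c, c + c = twiceC L g h) :
    GromovIntegral (dist hL) := by
  intro v x y
  induction v using Quotient.inductionOn with | _ o
  induction x using Quotient.inductionOn with | _ p
  induction y using Quotient.inductionOn with | _ q
  obtain ⟨a, ha⟩ := exists_add_self_eq_preMeet hi o p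
  obtain ⟨b, hb⟩ := exists_add_self_eq_preMeet hi o q
  obtain ⟨c, hc⟩ := exists_add_self_eq_preMeet hi p q
  refine ⟨o.n - a - b + c, ?_⟩
  change _ = preDist L o p + preDist L o q - preDist L p q
  rw [preDist_eq, preDist_eq, preDist_eq, ← ha, ← hb, ← hc]
  abel

/-- The path from `p` to `q` descends the interval of `p` to the branch point at height `c`, then
climbs the interval of `q`. After distance `r` the height is `p.n - r` on the first part and `c + (r
- (p.n - c))` on the second. -/
theorem hasIntermediate_dist (hL : IsLengthFunction L) (hi : ∀ g h, ∃ c, c + c = twiceC L g h) :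
    HasIntermediate (dist hL) := by
  intro x y r h0 h1
  induction x using Quotient.inductionOn with | _ p
  induction y using Quotient.inductionOn with | _ q
  obtain ⟨c, hc⟩ := exists_add_self_eq_preMeet hi p q
  change r ≤ preDist L p q at h1
  have e1 := preMeet_nonneg hL p q
  have e2 := preMeet_le_left p q
  have e3 := preMeet_le_right p q
  have e4 := p.le
  have e5 := q.le
  have e6 := p.nonneg
  have e7 := q.nonneg
  have e8 := hL.twiceC_self p.g
  have e9 := hL.twiceC_self q.g
  rw [preDist_eq] at h1
  rcases le_total r (p.n - c) with h | h
  · refine ⟨point hL (p.n - r) p.g (by grind) (by grind), ?_, ?_⟩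
    · change preDist L p ⟨p.n - r, p.g, _, _⟩ + preDist L ⟨p.n - r, p.g, _, _⟩ q = preDist L p q
      rw [preMeet] at *
      simp only [preDist]
      grind
    · change preDist L p ⟨p.n - r, p.g, _, _⟩ = r
      rw [preMeet] at *
      simp only [preDist]
      grind
  · refine ⟨point hL (r + c + c - p.n) q.g (by grind) (by grind), ?_, ?_⟩
    · change preDist L p ⟨r + c + c - p.n, q.g, _, _⟩ +
        preDist L ⟨r + c + c - p.n, q.g, _, _⟩ q = preDist L p q
      rw [preMeet] at *
      simp only [preDist]
      grind
    · change preDist L p ⟨r + c + c - p.n, q.g, _, _⟩ = r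
      rw [preMeet] at *
      simp only [preDist]
      grind

theorem isLambdaTree_dist (hL : IsLengthFunction L) (hi : ∀ g h, ∃ c, c + c = twiceC L g h) :
    IsLambdaTree (dist hL) :=
  isLambdaTree_of_isHyperbolic (isLambdaMetric_dist hL) (isHyperbolic_dist hL)
    (hasIntermediate_dist hL hi) (gromovIntegral_dist hL hi)

theorem dist_ofGroup (hL : IsLengthFunction L) (g h : G) :
    dist hL (ofGroup hL g) (ofGroup hL h) = L (g⁻¹ * h) := by
  change L g + L h - min (min (L g + L g) (L h + L h)) (twiceC L g h) = _
  have h1 := hL.twiceC_le g h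
  have h2 := hL.twiceC_le h g
  rw [hL.twiceC_symm] at h2
  rw [min_eq_right (le_min h1 h2), twiceC]
  abel

theorem dist_one_point (hL : IsLengthFunction L) (n : Λ) (g : G) (h0 : 0 ≤ n) (h1 : n ≤ L g) :
    dist hL (ofGroup hL 1) (point hL n g h0 h1) = n := by
  change L 1 + n - min (min (L 1 + L 1) (n + n)) (twiceC L 1 g) = n
  have h2 := hL.twiceC_nonneg 1 g
  rw [hL.map_one] at *
  grind

theorem dist_point_ofGroup (hL : IsLengthFunction L) (n : Λ) (g : G) (h0 : 0 ≤ n)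
    (h1 : n ≤ L g) : dist hL (point hL n g h0 h1) (ofGroup hL g) = L g - n := by
  change n + L g - min (min (n + n) (L g + L g)) (twiceC L g g) = _
  rw [hL.twiceC_self]
  grind

theorem point_mem_between (hL : IsLengthFunction L) (n : Λ) (g : G) (h0 : 0 ≤ n)
    (h1 : n ≤ L g) :
    point hL n g h0 h1 ∈ between (dist hL) (ofGroup hL 1) (ofGroup hL g) := by
  change _ + _ = _
  rw [dist_one_point, dist_point_ofGroup, dist_ofGroup, inv_one, one_mul]
  abel

theorem dist_smul_ofGroup (hL : IsLengthFunction L) (h k : G) (x : Tree hL) :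
    dist hL (h • x) (ofGroup hL (h * k)) = dist hL x (ofGroup hL k) := by
  have := dist_smul hL h (h * k) x
  rwa [inv_mul_cancel_left] at this

theorem smul_mem_between (hL : IsLengthFunction L) (h g k : G) {x : Tree hL}
    (hx : x ∈ between (dist hL) (ofGroup hL g) (ofGroup hL k)) :
    h • x ∈ between (dist hL) (ofGroup hL (h * g)) (ofGroup hL (h * k)) := by
  have hx' : _ + _ = _ := hx
  change _ + _ = _
  rw [(isLambdaMetric_dist hL).symm, dist_smul_ofGroup, dist_smul_ofGroup, dist_ofGroup,
    (isLambdaMetric_dist hL).symm, hx', dist_ofGroup]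
  congr 1
  group

/-- The point `y` lies between `1` and some `g`, so its distance to `x` is computed from distances
to points of `G`. The action of `h` preserves these distances when it translates the points of `G`,
and it carries `y` between `h` and `h * g`. -/
theorem dist_smul_smul (hL : IsLengthFunction L) (h : G) (x y : Tree hL) :
    dist hL (h • x) (h • y) = dist hL x y := by
  obtain ⟨n, g, h0, h1, rfl⟩ : ∃ n g h0 h1, point hL n g h0 h1 = y := by
    induction y using Quotient.inductionOn with | _ q
    exact ⟨q.n, q.g, q.nonneg, q.le, rfl⟩
  have hy := point_mem_between hL n g h0 h1
  have hm := isLambdaMetric_dist hL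
  rw [dist_eq_max_of_between hm (isHyperbolic_dist hL) hy,
    dist_eq_max_of_between hm (isHyperbolic_dist hL) (smul_mem_between hL h _ _ hy),
    dist_smul_ofGroup, dist_smul_ofGroup, dist_smul_ofGroup, hm.symm _ (h • _),
    dist_smul_ofGroup, hm.symm (point hL n g h0 h1), dist_ofGroup, dist_ofGroup]
  simp [hm.symm _ (ofGroup hL 1)]

/-- A fixed point is equidistant from `1`, `h` and `h * h`. Hyperbolicity based there makes the
distance from `1` to `h * h` at most the larger of the two steps, each of which is `L h`. -/
theorem length_sq_le_of_smul_eq (hL : IsLengthFunction L) {h : G} {x : Tree hL}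
    (hx : h • x = x) : L (h * h) ≤ L h := by
  have hm := isLambdaMetric_dist hL
  have e : ∀ k, dist hL x (ofGroup hL (h * k)) = dist hL x (ofGroup hL k) := fun k => by
    conv_lhs => rw [← hx]
    rw [dist_smul_ofGroup]
  have h1 := (isHyperbolic_dist hL).min_le x (ofGroup hL 1) (ofGroup hL (h * h)) (ofGroup hL h)
  have e1 := e 1
  have e2 := e h
  have e3 := hL.inv h
  simp only [dist_ofGroup] at h1
  simp only [mul_one, inv_one, one_mul, mul_inv_rev, inv_mul_cancel_right, ← e3] at *
  grind

end Tree

end Tree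

end BigFree

namespace BigFree

/-! ### Prefixes with respect to a length function, and cyclic reduction. -/

section Prefix

variable {G : Type w} [Group G] {Λ : Type v} [AddCommGroup Λ] {L : G → Λ}

/-- `p` is a prefix of `g`: the product `p * (p⁻¹ * g)` is without cancellation. -/
def IsPrefix (L : G → Λ) (p g : G) : Prop := L g = L p + L (p⁻¹ * g)

theorem IsPrefix.twiceC_eq {p g : G} (h : IsPrefix L p g) : twiceC L p g = L p + L p := by
  rw [twiceC, h]; abel

variable [LinearOrder Λ] [IsOrderedAddMonoid Λ]

/-- Symmetry and subadditivity suffice. They are assumed in place of `IsLengthFunction L` because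
the lemma is used to prove that `BF.length` is a length function. -/
theorem IsPrefix.trans (hi : ∀ g, L g⁻¹ = L g) (ha : ∀ g h, L (g⁻¹ * h) ≤ L g + L h) {p q g : G}
    (h1 : IsPrefix L p q) (h2 : IsPrefix L q g) : IsPrefix L p g := by
  have h3 := ha p⁻¹ (p⁻¹ * g)
  have h4 := ha (p⁻¹ * q)⁻¹ (q⁻¹ * g)
  rw [inv_inv, mul_inv_cancel_left, hi] at h3
  rw [inv_inv, mul_assoc, mul_inv_cancel_left, hi] at h4
  rw [IsPrefix] at *
  grind

theorem IsPrefix.add_self_le_twiceC (ha : ∀ g h, L (g⁻¹ * h) ≤ L g + L h) {p g h : G}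
    (hg : IsPrefix L p g) (hh : IsPrefix L p h) : L p + L p ≤ twiceC L g h := by
  have h1 := ha (p⁻¹ * g) (p⁻¹ * h)
  rw [mul_inv_rev, inv_inv, mul_assoc, mul_inv_cancel_left] at h1
  rw [IsPrefix] at hg hh
  rw [twiceC, hg, hh]
  grind

theorem IsLengthFunction.le_add (hL : IsLengthFunction L) (g h : G) :
    L (g⁻¹ * h) ≤ L g + L h := sub_nonneg.1 (hL.twiceC_nonneg g h)

/-- For prefixes of `k`, `c(p, k) = L p` and `c(q, k) = L q`, so `hyp` gives `c(p, q) ≥ L p`.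
Prefixes of one element are thus nested. -/
theorem IsPrefix.of_le (hL : IsLengthFunction L) {p q k : G} (hp : IsPrefix L p k)
    (hq : IsPrefix L q k) (h : L p ≤ L q) : IsPrefix L p q := by
  have h1 := hL.hyp p q k
  rw [hp.twiceC_eq, hq.twiceC_eq, min_eq_left (add_le_add h h), twiceC] at h1
  have h2 := hL.le_add p⁻¹ (p⁻¹ * q)
  rw [inv_inv, mul_inv_cancel_left, ← hL.inv] at h2
  rw [IsPrefix]
  grind

/-- If every two elements have a common prefix whose removal leaves no cancellation, and there is
no `2`-torsion, then `L g < L (g * g)` for `g ≠ 1`. -/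
theorem IsLengthFunction.eq_one_of_length_sq_le (hL : IsLengthFunction L)
    (hc : ∀ g h, ∃ p, IsPrefix L p g ∧ IsPrefix L p h ∧
      L (g⁻¹ * h) = L (p⁻¹ * g) + L (p⁻¹ * h))
    (ht : ∀ k : G, k * k = 1 → k = 1) {g : G} (hg : L (g * g) ≤ L g) : g = 1 := by
  obtain ⟨p, hp', hp, h⟩ := hc g⁻¹ g
  rw [inv_inv] at h
  -- Cyclic reduction: `g` starts with `p` and ends with `p⁻¹`. Since `L (g * g) = L (g * p) + L
  -- (p⁻¹ * g)` and `L g = L p + L (p⁻¹ * g)`, the hypothesis `hg` says `L (g * p) ≤ L p`.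
  have e1 : L (p⁻¹ * g⁻¹) = L (g * p) := by rw [hL.inv]; simp
  have hp1 : L g = L p + L (p⁻¹ * g) := hp
  have hp2 : L g⁻¹ = L p + L (p⁻¹ * g⁻¹) := hp'
  rw [← hL.inv, e1] at hp2
  rw [e1] at h
  have hb : IsPrefix L (g * p) g := by
    rw [IsPrefix, mul_inv_rev, inv_mul_cancel_right, ← hL.inv p]
    grind
  rcases le_total (L p) (L (g * p)) with hle | hle
  · have h1 : L (g * p) = L p + L (p⁻¹ * (g * p)) := hp.of_le hL hb hle
    have h2 := hL.nonneg (p⁻¹ * (g * p))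
    have h3 : L (p⁻¹ * (g * p)) = 0 := by grind
    rw [hL.eq_zero_iff, inv_mul_eq_one] at h3
    exact right_eq_mul.1 h3
  · have h1 : L p = L (g * p) + L ((g * p)⁻¹ * p) := hb.of_le hL hp hle
    -- Here `k` is the conjugate `p⁻¹ * g⁻¹ * p`. Both `k` and `k⁻¹` are prefixes of `p⁻¹`, of the
    -- same length, so they coincide and `k * k = 1`.
    obtain ⟨k, hk⟩ : ∃ k, k = (g * p)⁻¹ * p := ⟨_, rfl⟩
    have k1 : IsPrefix L k p⁻¹ := by
      rw [IsPrefix, ← hL.inv, show k⁻¹ * p⁻¹ = p⁻¹ * g by rw [hk]; group, hk]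
      grind
    have k2 : IsPrefix L k⁻¹ p⁻¹ := by
      rw [IsPrefix, ← hL.inv, ← hL.inv, inv_inv, show k * p⁻¹ = (g * p)⁻¹ by rw [hk]; group,
        ← hL.inv, hk]
      grind
    have k3 : L k = L k⁻¹ + L (k⁻¹⁻¹ * k) := k2.of_le hL k1 (hL.inv k).ge
    rw [← hL.inv, inv_inv, left_eq_add, hL.eq_zero_iff] at k3
    have k4 := ht k k3
    rw [k4, eq_comm, inv_mul_eq_one] at hk
    simpa using hk

end Prefix

end BigFree

namespace BigFree

/-! ### Finite noncrossing pairings and products in free groups. -/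

section WordProd

variable {A : Type u} {S : Type v} [LinearOrder S]

theorem Letter.inv_fst (l : Letter A) : l.inv.1 = l.1 := rfl

theorem Letter.inv_ne (l : Letter A) : l.inv ≠ l := by simp [Letter.inv, Prod.ext_iff]

/-- The element of the free group spelled by the letters at a finite set of positions. -/
def wordProd (f : S → Letter A) (P : Finset S) : FreeGroup A := FreeGroup.mk (P.sort.map f)

theorem wordProd_empty (f : S → Letter A) : wordProd f ∅ = 1 := by
  simp [wordProd, FreeGroup.one_eq_mk]

theorem wordProd_singleton (f : S → Letter A) (x : S) : wordProd f {x} = FreeGroup.mk [f x] := by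
  simp [wordProd]

theorem wordProd_union (f : S → Letter A) {P Q : Finset S} (h : ∀ p ∈ P, ∀ q ∈ Q, p < q) :
    wordProd f (P ∪ Q) = wordProd f P * wordProd f Q := by
  have h1 : (P ∪ Q).sort = P.sort ++ Q.sort := by
    have hn : (P.sort ++ Q.sort).Nodup := by
      refine List.nodup_append.2 ⟨P.sort_nodup _, Q.sort_nodup _, fun a ha b hb => ?_⟩
      exact (h a ((P.mem_sort _).1 ha) b ((Q.mem_sort _).1 hb)).ne
    have h2 := (List.toFinset_sort (· ≤ ·) hn).2 <| by
      refine List.pairwise_append.2 ⟨P.pairwise_sort _, Q.pairwise_sort _, fun a ha b hb => ?_⟩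
      exact (h a ((P.mem_sort _).1 ha) b ((Q.mem_sort _).1 hb)).le
    rwa [List.toFinset_append, Finset.sort_toFinset, Finset.sort_toFinset] at h2
  rw [wordProd, h1, List.map_append, ← FreeGroup.mul_mk]
  rfl

theorem wordProd_map {S' : Type w} [LinearOrder S'] (f : S' → Letter A) (e : S ↪o S')
    (P : Finset S) : wordProd f (P.map e.toEmbedding) = wordProd (f ∘ e) P := by
  have := Finset.map_sort (r := (· ≤ ·)) (r' := (· ≤ ·)) e.toEmbedding P
    (fun a _ b _ => e.le_iff_le.symm)
  rw [wordProd, wordProd, ← this, List.map_map]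
  rfl

/-- Removing two neighbouring inverse letters does not change the product. -/
theorem wordProd_sdiff_pair (f : S → Letter A) {P : Finset S} {x y : S} (hx : x ∈ P) (hy : y ∈ P)
    (hxy : x < y) (hf : f y = (f x).inv) (h : ∀ z ∈ P, x < z → y ≤ z) :
    wordProd f (P \ {x, y}) = wordProd f P := by
  have e1 : P \ {x, y} = P.filter (· < x) ∪ P.filter (y < ·) := by
    ext z
    simp only [Finset.mem_sdiff, Finset.mem_insert, Finset.mem_singleton, Finset.mem_union,
      Finset.mem_filter]
    have := h z
    rcases lt_trichotomy z x with h1 | h1 | h1 <;> grind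
  have e2 : P = P.filter (· < x) ∪ ({x} ∪ ({y} ∪ P.filter (y < ·))) := by
    ext z
    simp only [Finset.mem_singleton, Finset.mem_union, Finset.mem_filter]
    have := h z
    rcases lt_trichotomy z x with h1 | h1 | h1 <;> grind
  have e3 : FreeGroup.mk [f x] * FreeGroup.mk [f y] = 1 := by
    rw [hf]
    exact mul_inv_cancel (FreeGroup.mk [f x])
  rw [e1, wordProd_union, eq_comm, e2, wordProd_union, wordProd_union, wordProd_union,
    wordProd_singleton, wordProd_singleton, ← e2, ← mul_assoc (FreeGroup.mk _), e3, one_mul]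
  all_goals
    simp only [Finset.mem_singleton, Finset.mem_union, Finset.mem_filter]
    grind

/-- Removing a finite cancellation does not change the product. -/
theorem wordProd_sdiff (f : S → Letter A) (star : S → S) (P Q : Finset S) (hQ : Q ⊆ P)
    (mapsTo : ∀ t ∈ Q, star t ∈ Q) (invol : ∀ t ∈ Q, star (star t) = t)
    (hc : ∀ t ∈ Q, ∀ s ∈ P, t ≤ s → s ≤ star t → s ∈ Q ∧ t ≤ star s ∧ star s ≤ star t)
    (hf : ∀ t ∈ Q, f (star t) = (f t).inv) : wordProd f (P \ Q) = wordProd f P := by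
  induction hn : Q.card using Nat.strong_induction_on generalizing P Q with | _ n ih
  rcases Q.eq_empty_or_nonempty with rfl | ⟨t, ht⟩
  · simp
  have hne : ∀ t ∈ Q, star t ≠ t := fun t ht h => Letter.inv_ne (f t) (by rw [← hf t ht, h])
  have hQ1 : (Q.filter fun t => t < star t).Nonempty := by
    rcases (hne t ht).lt_or_gt with h | h
    · exact ⟨star t, Finset.mem_filter.2 ⟨mapsTo t ht, by rwa [invol t ht]⟩⟩
    · exact ⟨t, Finset.mem_filter.2 ⟨ht, h⟩⟩
  -- The last left end of a pair. A position of `P` strictly between `x` and `star x` would have its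
  -- pair inside too, and that pair would have a later left end. So `x` and `star x` are neighbours
  -- in `P` and can be removed.
  obtain ⟨x, hx, hmax⟩ := Finset.exists_maximal hQ1
  rw [Finset.mem_filter] at hx
  obtain ⟨hxQ, hlt⟩ := hx
  have hadj : ∀ z ∈ P, x < z → star x ≤ z := by
    intro z hz hxz
    by_contra! h
    obtain ⟨h1, h2, h3⟩ := hc x hxQ z hz hxz.le h.le
    have hm : ∀ u ∈ Q, u < star u → x < u → False := fun u hu hu' hxu =>
      (hmax (Finset.mem_filter.2 ⟨hu, hu'⟩) hxu.le).not_gt hxu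
    rcases (hne z h1).lt_or_gt with h4 | h4
    · refine hm (star z) (mapsTo z h1) (by rwa [invol z h1]) (lt_of_le_of_ne h2 fun h5 => ?_)
      rw [h5, invol z h1] at h
      exact h.false
    · exact hm z h1 h4 hxz
  have hsub : ({x, star x} : Finset S) ⊆ Q := by
    intro z hz
    simp only [Finset.mem_insert, Finset.mem_singleton] at hz
    rcases hz with rfl | rfl
    exacts [hxQ, mapsTo _ hxQ]
  rw [← wordProd_sdiff_pair f (hQ hxQ) (hQ (mapsTo _ hxQ)) hlt (hf _ hxQ) hadj,
    ← ih (Q \ {x, star x}).card ?_ (P \ {x, star x}) (Q \ {x, star x}) ?_ ?_ ?_ ?_ ?_ rfl]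
  · congr 1
    ext z
    simp only [Finset.mem_sdiff]
    have := @hsub z
    tauto
  · rw [← hn]
    exact Finset.card_lt_card ⟨Finset.sdiff_subset, fun h =>
      (Finset.mem_sdiff.1 (h hxQ)).2 (by simp)⟩
  · exact Finset.sdiff_subset_sdiff hQ le_rfl
  · simp only [Finset.mem_sdiff, Finset.mem_insert, Finset.mem_singleton]
    grind
  · simp only [Finset.mem_sdiff]
    exact fun t ht => invol t ht.1
  · simp only [Finset.mem_sdiff]
    intro t ht s hs h1 h2
    obtain ⟨h3, h4⟩ := hc t ht.1 s hs.1 h1 h2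
    exact ⟨⟨h3, hs.2⟩, h4⟩
  · simp only [Finset.mem_sdiff]
    exact fun t ht => hf t ht.1

/-- A finite set of positions with trivial product has a complete noncrossing pairing of inverse
letters. -/
theorem exists_pairing_of_wordProd_eq_one (f : S → Letter A) (P : Finset S)
    (h : wordProd f P = 1) : ∃ star : S → S, (∀ t ∈ P, star t ∈ P) ∧
      (∀ t ∈ P, star (star t) = t) ∧
      (∀ t ∈ P, ∀ s ∈ P, t ≤ s → s ≤ star t → t ≤ star s ∧ star s ≤ star t) ∧
      ∀ t ∈ P, f (star t) = (f t).inv := by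
  classical
  induction hn : P.card using Nat.strong_induction_on generalizing P with | _ n ih
  rcases P.eq_empty_or_nonempty with rfl | hP
  · exact ⟨id, by simp⟩
  obtain ⟨x, hx, y, hy, hxy, hf, hadj⟩ : ∃ x ∈ P, ∃ y ∈ P, x < y ∧ f y = (f x).inv ∧
      ∀ z ∈ P, x < z → y ≤ z := by
    -- A nonempty list spelling `1` is not reduced, so two neighbouring letters are inverse. They
    -- are paired with each other, and the rest is paired by induction; no crossing arises because
    -- no position of `P` lies between them.
    have h1 : ¬ FreeGroup.IsReduced (P.sort.map f) := by
      intro h1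
      have h2 := FreeGroup.reduce.sound (h.trans FreeGroup.one_eq_mk)
      rw [h1.reduce_eq, FreeGroup.IsReduced.nil.reduce_eq, List.map_eq_nil_iff] at h2
      have := P.length_sort (· ≤ ·)
      rw [h2, List.length_nil] at this
      exact hP.card_ne_zero this.symm
    rw [FreeGroup.IsReduced, List.isChain_iff_getElem] at h1
    push Not at h1
    obtain ⟨i, hi, h2, h3⟩ := h1
    simp only [List.length_map, List.getElem_map] at hi h2 h3
    have hlt := P.sortedLT_sort
    refine ⟨P.sort[i], (P.mem_sort (· ≤ ·)).1 (List.getElem_mem _), P.sort[i + 1],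
      (P.mem_sort (· ≤ ·)).1 (List.getElem_mem _), ?_, ?_, ?_⟩
    · exact hlt.getElem_lt_getElem_iff.2 (by omega)
    · refine Prod.ext h2.symm ?_
      simp only [Letter.inv]
      revert h3
      cases (f P.sort[i]).2 <;> cases (f P.sort[i + 1]).2 <;> simp
    · intro z hz hxz
      obtain ⟨j, hj, rfl⟩ := List.getElem_of_mem ((P.mem_sort (· ≤ ·)).2 hz)
      have := hlt.getElem_lt_getElem_iff.1 hxz
      by_contra! hlt'
      have := hlt.getElem_lt_getElem_iff.1 hlt'
      omega
  obtain ⟨star, h1, h2, h3, h4⟩ := ih (P \ {x, y}).card (by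
    rw [← hn]
    exact Finset.card_lt_card ⟨Finset.sdiff_subset, fun h =>
      (Finset.mem_sdiff.1 (h hx)).2 (by simp)⟩) (P \ {x, y})
    ((wordProd_sdiff_pair f hx hy hxy hf hadj).trans h) rfl
  simp only [Finset.mem_sdiff, Finset.mem_insert, Finset.mem_singleton, not_or] at h1 h2 h3 h4
  have hf' : f x = (f y).inv := by rw [hf, Letter.inv_inv]
  refine ⟨fun s => if s = x then y else if s = y then x else star s, ?_, ?_, ?_, ?_⟩
  · intro t ht
    have a1 := h1 t
    dsimp only
    split_ifs <;> tauto
  · intro t ht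
    have a1 := h1 t
    have a2 := h2 t
    dsimp only
    split_ifs <;> grind only
  · intro t ht s hs h5 h6
    dsimp only at h6 ⊢
    by_cases tx : t = x
    · subst tx
      rw [if_pos rfl] at h6 ⊢
      by_cases sx : s = t
      · simp [sx, hxy.le]
      · have : s = y := le_antisymm h6 (hadj s hs (lt_of_le_of_ne h5 (Ne.symm sx)))
        simp [this, hxy.le, hxy.ne']
    by_cases ty : t = y
    · subst ty
      rw [if_neg tx, if_pos rfl] at h6
      exact absurd (h5.trans h6) hxy.not_ge
    rw [if_neg tx, if_neg ty] at h6 ⊢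
    obtain ⟨b1, b2, b3⟩ := h1 t ⟨ht, tx, ty⟩
    by_cases sx : s = x
    · subst sx
      rw [if_pos rfl]
      exact ⟨h5.trans hxy.le, hadj _ b1 (lt_of_le_of_ne h6 (Ne.symm b2))⟩
    by_cases sy : s = y
    · subst sy
      rw [if_neg sx, if_pos rfl]
      refine ⟨le_of_not_gt fun h => ?_, hxy.le.trans h6⟩
      exact absurd (hadj t ht h) (lt_of_le_of_ne h5 ty).not_ge
    rw [if_neg sx, if_neg sy]
    exact h3 t ⟨ht, tx, ty⟩ s ⟨hs, sx, sy⟩ h5 h6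
  · intro t ht
    have a1 := h1 t
    have a2 := h4 t
    dsimp only
    split_ifs <;> grind only

end WordProd

end BigFree

namespace BigFree

/-! ### Transfinite words: reduction, and detection of trivial words by finite projections. -/

namespace Word

variable {A : Type u}

/-! ### Cancellations -/

theorem IsCancellation.between {w : Word A} {T : Set w.S} {star : w.S → w.S}
    (h : w.IsCancellation T star) {t s : w.S} (ht : t ∈ T) (h1 : t ≤ s) (h2 : s ≤ star t) :
    s ∈ T ∧ t ≤ star s ∧ star s ≤ star t := by
  refine ⟨h.complete t ht ⟨h1, h2⟩, ?_⟩
  have := h.noncrossing t ht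
  exact this.subset (Set.mem_image_of_mem star ⟨h1, h2⟩)

/-- Since `star` is an involution, mapping each interval into itself already makes it map onto
itself. The pointwise condition is easier to check. -/
theorem IsCancellation.of_between {w : Word A} {T : Set w.S} {star : w.S → w.S}
    (mapsTo : ∀ t ∈ T, star t ∈ T) (invol : ∀ t ∈ T, star (star t) = t)
    (between : ∀ t ∈ T, ∀ s, t ≤ s → s ≤ star t → s ∈ T ∧ t ≤ star s ∧ star s ≤ star t)
    (inverse : ∀ t ∈ T, w.letter (star t) = (w.letter t).inv) : w.IsCancellation T star where
  mapsTo := mapsTo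
  invol := invol
  complete t ht s hs := (between t ht s hs.1 hs.2).1
  noncrossing t ht := by
    apply Set.Subset.antisymm
    · rintro _ ⟨s, hs, rfl⟩
      exact (between t ht s hs.1 hs.2).2
    · intro s hs
      have h := between t ht s hs.1 hs.2
      exact ⟨star s, h.2, invol s h.1⟩
  inverse := inverse

/-- In a cancellation, no two positions in a reduced convex subword are paired. -/
theorem IsCancellation.star_ne {w v : Word A} {T : Set w.S} {star : w.S → w.S}
    (h : w.IsCancellation T star) (hv : v.IsReduced) (e : v.S ↪o w.S)
    (he : ∀ s, w.letter (e s) = v.letter s) (hc : (Set.range e).OrdConnected) (s t : v.S)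
    (hs : e s ∈ T) : star (e s) ≠ e t := by
  classical
  intro hst
  have hex : ∀ x : v.S, ∃ y : v.S, (∃ z, star (e x) = e z) → star (e x) = e y := fun x => by
    by_cases hx : ∃ z, star (e x) = e z
    · exact ⟨hx.choose, fun _ => hx.choose_spec⟩
    · exact ⟨x, fun h => absurd h hx⟩
  choose st hst' using hex
  -- The pairs with both ends in the subword form a cancellation of it: a position between the ends
  -- of such a pair has its partner between them, hence in the subword by convexity.
  have key : v.IsCancellation {x | e x ∈ T ∧ ∃ z, star (e x) = e z} st := by
    apply IsCancellation.of_between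
    · rintro x ⟨hx, hz⟩
      rw [Set.mem_ofPred_eq, ← hst' x hz, h.invol _ hx]
      exact ⟨h.mapsTo _ hx, x, rfl⟩
    · rintro x ⟨hx, hz⟩
      have h1 := hst' (st x) ⟨x, by rw [← hst' x hz, h.invol _ hx]⟩
      rw [← hst' x hz, h.invol _ hx] at h1
      exact (e.injective h1).symm
    · rintro x ⟨hx, hz⟩ y h1 h2
      rw [← e.le_iff_le, ← hst' x hz] at h2
      obtain ⟨h3, h4, h5⟩ := h.between hx (e.le_iff_le.2 h1) h2
      rw [hst' x hz] at h5
      obtain ⟨z, hz'⟩ := hc.out ⟨x, rfl⟩ ⟨st x, rfl⟩ ⟨h4, h5⟩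
      rw [hst' y ⟨z, hz'.symm⟩] at h4 h5
      exact ⟨⟨h3, z, hz'.symm⟩, e.le_iff_le.1 h4, e.le_iff_le.1 h5⟩
    · rintro x ⟨hx, hz⟩
      rw [← he, ← he, ← hst' x hz, h.inverse _ hx]
  have := hv _ _ key
  exact Set.eq_empty_iff_forall_notMem.1 this s ⟨hs, t, hst⟩

/-- A convex subword of a reduced word is reduced. -/
theorem IsReduced.of_embedding {w v : Word A} (hw : w.IsReduced) (e : v.S ↪o w.S)
    (he : ∀ s, w.letter (e s) = v.letter s) (hc : (Set.range e).OrdConnected) :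
    v.IsReduced := by
  classical
  intro T star h
  have hst : ∀ s, Function.extend e (fun t => e (star t)) id (e s) = e (star s) := fun s =>
    e.injective.extend_apply _ _ s
  have key : w.IsCancellation (e '' T) (Function.extend e (fun t => e (star t)) id) := by
    apply IsCancellation.of_between
    · rintro _ ⟨s, hs, rfl⟩
      rw [hst]
      exact Set.mem_image_of_mem e (h.mapsTo s hs)
    · rintro _ ⟨s, hs, rfl⟩
      rw [hst, hst, h.invol s hs]
    · rintro _ ⟨s, hs, rfl⟩ t h1 h2
      rw [hst] at h2 ⊢
      obtain ⟨t, rfl⟩ := hc.out ⟨s, rfl⟩ ⟨_, rfl⟩ ⟨h1, h2⟩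
      rw [hst, e.le_iff_le, e.le_iff_le]
      rw [e.le_iff_le] at h1 h2
      obtain ⟨h3, h4⟩ := h.between hs h1 h2
      exact ⟨Set.mem_image_of_mem e h3, h4⟩
    · rintro _ ⟨s, hs, rfl⟩
      rw [hst, he, he, h.inverse s hs]
  exact Set.image_eq_empty.1 (hw _ _ key)

theorem IsReduced.inverse {w : Word A} (hw : w.IsReduced) : w.inverse.IsReduced := by
  intro T star h
  refine hw T star (IsCancellation.of_between (w := w) h.mapsTo h.invol ?_ ?_)
  · intro t ht s h1 h2
    have h3 : star (star t) = t := h.invol t ht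
    have h4 := h.between (t := star t) (s := s) (h.mapsTo t ht) h2 (by rw [h3]; exact h1)
    rw [h3] at h4
    exact ⟨h4.1, h4.2.2, h4.2.1⟩
  · intro t ht
    have h1 : (w.letter (star t)).inv = (w.letter t).inv.inv := h.inverse t ht
    rw [← Letter.inv_inv (w.letter (star t)), h1, Letter.inv_inv]

theorem isReduced_empty : (empty A).IsReduced := fun _ _ _ => Set.eq_empty_of_isEmpty _

/-! ### Restriction to a set of positions -/

/-- The restriction of a word to a set of positions. -/
@[reducible] def restrict (w : Word A) (Z : Set w.S) : Word A where
  S := {s : w.S // s ∈ Z}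
  letter s := w.letter s.1
  finite_fiber l := (w.finite_fiber l).preimage (f := Subtype.val) Subtype.val_injective.injOn

theorem IsCancellation.arises_restrict {w : Word A} {T : Set w.S} {star : w.S → w.S}
    (h : w.IsCancellation T star) : Arises w (w.restrict Tᶜ) :=
  ⟨T, star, h, OrderIso.refl _, fun _ => rfl⟩

theorem IsReduced.restrict {w : Word A} (hw : w.IsReduced) {Z : Set w.S} (hZ : Z.OrdConnected) :
    (w.restrict Z).IsReduced := by
  refine hw.of_embedding (v := w.restrict Z) (OrderEmbedding.subtype (· ∈ Z)) (fun _ => rfl) ?_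
  have : Set.range (OrderEmbedding.subtype (· ∈ Z)) = Z := Subtype.range_coe
  rwa [this]

/-- A word is the concatenation of its restrictions to a lower set and to the complement. -/
theorem restrict_append_iso (w : Word A) {I : Set w.S} (hI : IsLowerSet I) :
    ((w.restrict I).append (w.restrict Iᶜ)).Iso w := by
  classical
  let f : ((w.restrict I).append (w.restrict Iᶜ)).S → w.S := fun s =>
    Sum.elim Subtype.val Subtype.val (ofLex s)
  have hf : StrictMono f := by
    rintro (a | a) (b | b) h
    · have h1 : a < b := Sum.Lex.inl_lt_inl_iff.1 h
      exact h1
    · exact lt_of_not_ge fun h => b.2 (hI h a.2)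
    · exact (Sum.Lex.not_inr_lt_inl h).elim
    · have h1 : a < b := Sum.Lex.inr_lt_inr_iff.1 h
      exact h1
  have hs : Function.Surjective f := fun s => by
    by_cases h : s ∈ I
    · exact ⟨toLex (Sum.inl ⟨s, h⟩), rfl⟩
    · exact ⟨toLex (Sum.inr ⟨s, h⟩), rfl⟩
  refine ⟨hf.orderIsoOfSurjective f hs, ?_⟩
  rintro (s | s) <;> rfl

theorem restrict_restrict_iso (w : Word A) {I J : Set w.S} (h : I ⊆ J) :
    ((w.restrict J).restrict {s | s.1 ∈ I}).Iso (w.restrict I) := by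
  let f : {s : {s : w.S // s ∈ J} // s.1 ∈ I} → {s : w.S // s ∈ I} := fun s => ⟨s.1.1, s.2⟩
  have hf : StrictMono f := fun a b h => h
  have hs : Function.Surjective f := fun s => ⟨⟨⟨s.1, h s.2⟩, s.2⟩, rfl⟩
  exact ⟨hf.orderIsoOfSurjective f hs, fun s => rfl⟩

/-! ### Counting letters -/

theorem finite_fiber_fst (w : Word A) (a : A) : {s : w.S | (w.letter s).1 = a}.Finite := by
  refine ((w.finite_fiber (a, true)).union (w.finite_fiber (a, false))).subset fun s hs => ?_
  rcases h : w.letter s with ⟨b, _ | _⟩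
  · right; simpa [h] using hs
  · left; simpa [h] using hs

theorem Iso.count_eq {w v : Word A} (h : w.Iso v) (a : A) : w.count a = v.count a := by
  obtain ⟨e, he⟩ := h
  rw [count, count, ← Set.ncard_image_of_injective _ e.injective]
  congr 1
  ext s
  constructor
  · rintro ⟨t, ht, rfl⟩
    rw [Set.mem_ofPred_eq, he]
    exact ht
  · intro hs
    refine ⟨e.symm s, ?_, e.apply_symm_apply s⟩
    rw [Set.mem_ofPred_eq, ← he, e.apply_symm_apply]
    exact hs

theorem count_inverse (w : Word A) (a : A) : w.inverse.count a = w.count a := rfl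

theorem count_append (w v : Word A) (a : A) : (w.append v).count a = w.count a + v.count a := by
  let i : w.S → w.S ⊕ₗ v.S := fun s => toLex (Sum.inl s)
  let j : v.S → w.S ⊕ₗ v.S := fun s => toLex (Sum.inr s)
  have hi : Function.Injective i := fun a b h => Sum.inl_injective h
  have hj : Function.Injective j := fun a b h => Sum.inr_injective h
  have e : {s : (w.append v).S | ((w.append v).letter s).1 = a} =
      i '' {s | (w.letter s).1 = a} ∪ j '' {s | (v.letter s).1 = a} := by
    ext s
    rcases s with s | s
    · constructor
      · exact fun h => Or.inl ⟨s, h, rfl⟩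
      · rintro (⟨t, ht, h⟩ | ⟨t, _, h⟩)
        · cases h; exact ht
        · cases h
    · constructor
      · exact fun h => Or.inr ⟨s, h, rfl⟩
      · rintro (⟨t, _, h⟩ | ⟨t, ht, h⟩)
        · cases h
        · cases h; exact ht
  have hd : Disjoint (i '' {s | (w.letter s).1 = a}) (j '' {s | (v.letter s).1 = a}) := by
    rw [Set.disjoint_left]
    rintro _ ⟨s, _, rfl⟩ ⟨t, _, h⟩
    cases h
  rw [count, e, Set.ncard_union_eq hd ((w.finite_fiber_fst a).image i)
    ((v.finite_fiber_fst a).image j), Set.ncard_image_of_injective _ hi,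
    Set.ncard_image_of_injective _ hj]
  rfl

theorem isEmpty_of_count_eq_zero {w : Word A} (h : ∀ a, w.count a = 0) : IsEmpty w.S := by
  refine ⟨fun s => ?_⟩
  have h1 := (Set.ncard_eq_zero (w.finite_fiber_fst (w.letter s).1)).1 (h _)
  exact Set.eq_empty_iff_forall_notMem.1 h1 s rfl

theorem iso_empty (w : Word A) [IsEmpty w.S] : w.Iso (empty A) :=
  ⟨OrderIso.ofIsEmpty _ _, fun s => isEmptyElim s⟩

/-! ### Existence of reduced words -/

/-- The pairing `q.2` of the set `q.1` extends the pairing `p.2` of the set `p.1`. -/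
def Extends {S : Type u} (p q : Set S × (S → S)) : Prop := p.1 ⊆ q.1 ∧ ∀ t ∈ p.1, q.2 t = p.2 t

/-- Zorn's lemma applies: each condition on a cancellation concerns a single pair and the interval
it spans, so in the union of a chain it can be checked in one member. -/
theorem exists_maximal_cancellation (w : Word A) : ∃ p : Set w.S × (w.S → w.S),
    w.IsCancellation p.1 p.2 ∧ ∀ q : Set w.S × (w.S → w.S), w.IsCancellation q.1 q.2 →
      Extends p q → q.1 ⊆ p.1 := by
  classical
  have hz := exists_maximal_of_chains_bounded
    (r := fun p q : {p : Set w.S × (w.S → w.S) // w.IsCancellation p.1 p.2} => Extends p.1 q.1)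
    ?_ ?_
  · obtain ⟨m, hm⟩ := hz
    exact ⟨m.1, m.2, fun q hq hmq => (hm ⟨q, hq⟩ hmq).1⟩
  · intro c hc
    let star : w.S → w.S := fun t =>
      if h : ∃ p ∈ c, t ∈ p.1.1 then h.choose.1.2 t else t
    have hstar : ∀ p ∈ c, ∀ t ∈ p.1.1, star t = p.1.2 t := by
      intro p hp t ht
      have h : ∃ p ∈ c, t ∈ p.1.1 := ⟨p, hp, ht⟩
      have e : star t = h.choose.1.2 t := dif_pos h
      rw [e]
      obtain ⟨h1, h2⟩ := h.choose_spec
      by_cases hne : h.choose = p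
      · rw [hne]
      · rcases hc h1 hp hne with h3 | h3
        · exact (h3.2 t h2).symm
        · exact h3.2 t ht
    refine ⟨⟨(⋃ p ∈ c, p.1.1, star), ?_⟩, fun p hp => ⟨?_, ?_⟩⟩
    · simp only
      apply IsCancellation.of_between
      · intro t ht
        simp only [Set.mem_iUnion] at ht ⊢
        obtain ⟨p, hp, ht⟩ := ht
        refine ⟨p, hp, ?_⟩
        rw [hstar p hp t ht]
        exact p.2.mapsTo t ht
      · intro t ht
        simp only [Set.mem_iUnion] at ht
        obtain ⟨p, hp, ht⟩ := ht
        rw [hstar p hp t ht, hstar p hp _ (p.2.mapsTo t ht), p.2.invol t ht]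
      · intro t ht s h1 h2
        simp only [Set.mem_iUnion] at ht ⊢
        obtain ⟨p, hp, ht⟩ := ht
        rw [hstar p hp t ht] at h2 ⊢
        obtain ⟨h3, h4⟩ := p.2.between ht h1 h2
        rw [hstar p hp s h3]
        exact ⟨⟨p, hp, h3⟩, h4⟩
      · intro t ht
        simp only [Set.mem_iUnion] at ht
        obtain ⟨p, hp, ht⟩ := ht
        rw [hstar p hp t ht, p.2.inverse t ht]
    · exact Set.subset_biUnion_of_mem (u := fun p => p.1.1) hp
    · exact hstar p hp
  · intro p q r h1 h2
    exact ⟨h1.1.trans h2.1, fun t ht => (h2.2 t (h1.1 ht)).trans (h1.2 t ht)⟩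

/-- Every word has a cancellation leaving a reduced word. -/
theorem exists_isReduced_restrict (w : Word A) : ∃ (T : Set w.S) (star : w.S → w.S),
    w.IsCancellation T star ∧ (w.restrict Tᶜ).IsReduced := by
  classical
  obtain ⟨⟨T, star⟩, h, hmax⟩ := w.exists_maximal_cancellation
  refine ⟨T, star, h, fun T' star' h' => ?_⟩
  simp only at h hmax
  -- A cancellation of the remainder is merged with the maximal one; maximality then forces it to be
  -- empty.
  let star'' : w.S → w.S := fun t => if ht : t ∈ Tᶜ then (star' ⟨t, ht⟩).1 else star t
  have e1 : ∀ t ∈ T, star'' t = star t := fun t ht => dif_neg fun h => h ht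
  have e2 : ∀ t : (w.restrict Tᶜ).S, star'' t.1 = (star' t).1 := fun t => dif_pos t.2
  have key : w.IsCancellation (T ∪ Subtype.val '' T') star'' := by
    apply IsCancellation.of_between
    · rintro t (ht | ⟨t, ht, rfl⟩)
      · rw [e1 t ht]
        exact Or.inl (h.mapsTo t ht)
      · rw [e2]
        exact Or.inr ⟨_, h'.mapsTo t ht, rfl⟩
    · rintro t (ht | ⟨t, ht, rfl⟩)
      · rw [e1 t ht, e1 _ (h.mapsTo t ht), h.invol t ht]
      · rw [e2, e2, h'.invol t ht]
    · rintro t (ht | ⟨t, ht, rfl⟩) s h1 h2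
      · rw [e1 t ht] at h2 ⊢
        obtain ⟨h3, h4⟩ := h.between ht h1 h2
        rw [e1 s h3]
        exact ⟨Or.inl h3, h4⟩
      · rw [e2] at h2 ⊢
        by_cases hs : s ∈ T
        · rw [e1 s hs]
          -- An old pair cannot cross a new one: an end of the new pair would lie between the ends
          -- of the old pair, hence in `T` by completeness.
          refine ⟨Or.inl hs, le_of_not_gt fun h3 => ?_, le_of_not_gt fun h3 => ?_⟩
          · refine t.2 (h.between (h.mapsTo s hs) h3.le ?_).1
            rwa [h.invol s hs]
          · exact (star' t).2 (h.between hs h2 h3.le).1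
        · obtain ⟨h3, h4⟩ := h'.between (s := ⟨s, hs⟩) ht h1 h2
          have e3 : star'' s = (star' ⟨s, hs⟩).1 := e2 ⟨s, hs⟩
          rw [e3]
          exact ⟨Or.inr ⟨_, h3, rfl⟩, h4⟩
    · rintro t (ht | ⟨t, ht, rfl⟩)
      · rw [e1 t ht, h.inverse t ht]
      · rw [e2]
        exact h'.inverse t ht
  have hsub := hmax (_, star'') key ⟨Set.subset_union_left, e1⟩
  refine Set.eq_empty_of_forall_notMem fun t ht => t.2 (hsub (Or.inr ⟨t, ht, rfl⟩))

/-! ### Projections to free groups -/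

theorem finite_support (w : Word A) (F : Finset A) : {s : w.S | (w.letter s).1 ∈ F}.Finite := by
  refine (F.finite_toSet.biUnion fun a _ => w.finite_fiber_fst a).subset fun s hs => ?_
  simpa using hs

/-- The positions of the letters in `F` and their inverses. -/
noncomputable def support (w : Word A) (F : Finset A) : Finset w.S := (w.finite_support F).toFinset

theorem mem_support {w : Word A} {F : Finset A} {s : w.S} :
    s ∈ w.support F ↔ (w.letter s).1 ∈ F := by
  simp [support]

/-- The element of the free group spelled by the letters in `F` and their inverses. -/
noncomputable def proj (F : Finset A) (w : Word A) : FreeGroup A := wordProd w.letter (w.support F)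

theorem proj_empty (F : Finset A) : proj F (empty A) = 1 := by
  have : IsEmpty (empty A).S := inferInstanceAs (IsEmpty PEmpty)
  rw [proj, Finset.eq_empty_of_isEmpty (support _ F), wordProd_empty]

theorem proj_append (F : Finset A) (w v : Word A) :
    proj F (w.append v) = proj F w * proj F v := by
  let i : w.S ↪o w.S ⊕ₗ v.S := OrderEmbedding.ofStrictMono (fun s => toLex (Sum.inl s))
    fun _ _ h => Sum.Lex.inl_lt_inl_iff.2 h
  let j : v.S ↪o w.S ⊕ₗ v.S := OrderEmbedding.ofStrictMono (fun s => toLex (Sum.inr s))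
    fun _ _ h => Sum.Lex.inr_lt_inr_iff.2 h
  have e : (w.append v).support F =
      (w.support F).map i.toEmbedding ∪ (v.support F).map j.toEmbedding := by
    ext s
    rw [Finset.mem_union, Finset.mem_map, Finset.mem_map, mem_support]
    rcases s with s | s
    · constructor
      · exact fun h => Or.inl ⟨s, mem_support.2 h, rfl⟩
      · rintro (⟨t, ht, h⟩ | ⟨t, _, h⟩)
        · cases h; exact (mem_support (w := w)).1 ht
        · cases h
    · constructor
      · exact fun h => Or.inr ⟨s, mem_support.2 h, rfl⟩
      · rintro (⟨t, _, h⟩ | ⟨t, ht, h⟩)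
        · cases h
        · cases h; exact (mem_support (w := v)).1 ht
  have hlt : ∀ p ∈ (w.support F).map i.toEmbedding, ∀ q ∈ (v.support F).map j.toEmbedding,
      p < q := by
    simp only [Finset.mem_map]
    rintro _ ⟨s, _, rfl⟩ _ ⟨t, _, rfl⟩
    exact Sum.Lex.inl_lt_inr _ _
  rw [proj, e]
  refine (wordProd_union (w.append v).letter hlt).trans ?_
  rw [wordProd_map, wordProd_map]
  rfl

/-- Paired letters differ only by inversion, so `star` preserves the support of `F`. The
cancellation restricts there to a finite one, which does not change the product. -/
theorem Arises.proj_eq {w v : Word A} (h : Arises w v) (F : Finset A) : proj F w = proj F v := by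
  classical
  obtain ⟨T, star, hc, e, he⟩ := h
  have hm : StrictMono fun s : v.S => (e.symm s).1 := fun a b h => e.symm.strictMono h
  have hs := wordProd_sdiff w.letter star (w.support F) ((w.support F).filter (· ∈ T))
    (Finset.filter_subset _ _) ?_ ?_ ?_ ?_
  · have e1 : w.support F \ (w.support F).filter (· ∈ T) =
        (v.support F).map (OrderEmbedding.ofStrictMono _ hm).toEmbedding := by
      ext s
      simp only [Finset.mem_sdiff, Finset.mem_filter, Finset.mem_map, mem_support]
      constructor
      · rintro ⟨h1, h2⟩
        have h3 : s ∉ T := fun h => h2 ⟨h1, h⟩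
        refine ⟨e ⟨s, h3⟩, by rwa [he], ?_⟩
        change (e.symm (e ⟨s, h3⟩)).1 = s
        rw [e.symm_apply_apply]
      · rintro ⟨t, ht, rfl⟩
        obtain ⟨x, rfl⟩ := e.surjective t
        change (w.letter (e.symm (e x)).1).1 ∈ F ∧ ¬(_ ∧ (e.symm (e x)).1 ∈ T)
        rw [e.symm_apply_apply]
        rw [he] at ht
        exact ⟨ht, fun h => x.2 h.2⟩
    rw [e1, wordProd_map] at hs
    rw [proj, proj, ← hs]
    congr 1
    funext s
    change w.letter (e.symm s).1 = _
    rw [← he, e.apply_symm_apply]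
  · simp only [Finset.mem_filter, mem_support]
    rintro t ⟨h1, h2⟩
    refine ⟨?_, hc.mapsTo t h2⟩
    rwa [hc.inverse t h2, Letter.inv_fst]
  · simp only [Finset.mem_filter]
    exact fun t ht => hc.invol t ht.2
  · simp only [Finset.mem_filter]
    intro t ht s h1 h2 h3
    obtain ⟨h4, h5⟩ := hc.between ht.2 h2 h3
    exact ⟨⟨h1, h4⟩, h5⟩
  · simp only [Finset.mem_filter]
    exact fun t ht => hc.inverse t ht.2

theorem proj_eq_of_eqv {w v : Word A} (h : Relation.EqvGen Arises w v) (F : Finset A) :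
    proj F w = proj F v := by
  induction h with
  | rel _ _ h => exact h.proj_eq F
  | refl _ => rfl
  | symm _ _ _ ih => exact ih.symm
  | trans _ _ _ _ _ ih1 ih2 => exact ih1.trans ih2

/-- A word all of whose projections are trivial can be cancelled completely: the cancellation is
the limit along an ultrafilter of cancellations of the finite projections. -/
theorem exists_isCancellation_univ (w : Word A) (h : ∀ F, proj F w = 1) :
    ∃ star, w.IsCancellation Set.univ star := by
  classical
  choose st h1 h2 h3 h4 using fun F => exists_pairing_of_wordProd_eq_one w.letter (w.support F) (h F)
  let U : Ultrafilter (Finset A) := Ultrafilter.of Filter.atTop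
  have hev : ∀ s : w.S, ∀ᶠ F in U, s ∈ w.support F := fun s => by
    refine Ultrafilter.of_le _ ((Filter.eventually_ge_atTop {(w.letter s).1}).mono fun F hF => ?_)
    exact mem_support.2 (hF (Finset.mem_singleton_self _))
  -- The partner of `s` has the same underlying letter as `s`, which occurs only finitely often. So
  -- along the ultrafilter the partner is eventually constant.
  have hlim : ∀ s : w.S, ∃ t, ∀ᶠ F in U, st F s = t := fun s => by
    have : ∀ᶠ F in U, ∃ t ∈ {t | (w.letter t).1 = (w.letter s).1}, st F s = t := by
      filter_upwards [hev s] with F hF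
      refine ⟨_, ?_, rfl⟩
      rw [h4 F s hF, Letter.inv_fst]
    obtain ⟨t, _, ht⟩ := (Ultrafilter.eventually_exists_mem_iff (w.finite_fiber_fst _)).1 this
    exact ⟨t, ht⟩
  choose star hstar using hlim
  -- Each remaining condition involves finitely many positions, so a single `F` at which all the
  -- partners involved have their limit values proves it.
  refine ⟨star, IsCancellation.of_between (fun _ _ => trivial) (fun t _ => ?_)
    (fun t _ s hts hst => ⟨trivial, ?_⟩) (fun t _ => ?_)⟩
  · obtain ⟨F, e1, e2, e3⟩ := ((hev t).and ((hstar t).and (hstar (star t)))).exists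
    rw [← e3, ← e2, h2 F t e1]
  · obtain ⟨F, e1, e2, e3, e4⟩ :=
      ((hev t).and ((hev s).and ((hstar t).and (hstar s)))).exists
    rw [← e3] at hst ⊢
    rw [← e4]
    exact h3 F t e1 s e2 hts hst
  · obtain ⟨F, e1, e2⟩ := ((hev t).and (hstar t)).exists
    rw [← e2, h4 F t e1]

/-! ### Cancellations of `w⁻¹ v` -/

section InverseAppend

variable {w v : Word A}

/-- The position in `w⁻¹ v` of a position of `w`. -/
def posLeft (w v : Word A) (s : w.S) : (w.inverse.append v).S :=
  toLex (Sum.inl (OrderDual.toDual s))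

/-- The position in `w⁻¹ v` of a position of `v`. -/
def posRight (w v : Word A) (s : v.S) : (w.inverse.append v).S := toLex (Sum.inr s)

theorem posLeft_le_posLeft {s t : w.S} : posLeft w v s ≤ posLeft w v t ↔ t ≤ s :=
  Sum.Lex.inl_le_inl_iff

theorem posRight_le_posRight {s t : v.S} : posRight w v s ≤ posRight w v t ↔ s ≤ t :=
  Sum.Lex.inr_le_inr_iff

theorem posLeft_lt_posRight (s : w.S) (t : v.S) : posLeft w v s < posRight w v t :=
  Sum.Lex.inl_lt_inr _ _

theorem posLeft_injective : Function.Injective (posLeft w v) := fun _ _ h =>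
  le_antisymm (posLeft_le_posLeft.1 h.ge) (posLeft_le_posLeft.1 h.le)

theorem posRight_injective : Function.Injective (posRight w v) := fun _ _ h =>
  le_antisymm (posRight_le_posRight.1 h.le) (posRight_le_posRight.1 h.ge)

theorem exists_pos (x : (w.inverse.append v).S) :
    (∃ s, posLeft w v s = x) ∨ ∃ s, posRight w v s = x := by
  rcases x with s | s
  · exact Or.inl ⟨OrderDual.ofDual s, rfl⟩
  · exact Or.inr ⟨s, rfl⟩

variable {T : Set (w.inverse.append v).S}
  {star : (w.inverse.append v).S → (w.inverse.append v).S}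

/-- The part `w⁻¹` is convex and reduced, so no pair lies inside it: every pair straddles the
junction. -/
theorem IsCancellation.exists_star_posLeft (h : (w.inverse.append v).IsCancellation T star)
    (hw : w.IsReduced) {s : w.S} (hs : posLeft w v s ∈ T) :
    ∃ t, star (posLeft w v s) = posRight w v t := by
  rcases exists_pos (star (posLeft w v s)) with ⟨t, ht⟩ | ⟨t, ht⟩
  · let e : w.inverse.S ↪o (w.inverse.append v).S :=
      OrderEmbedding.ofMapLEIff (fun s => posLeft w v (OrderDual.ofDual s))
        fun a b => posLeft_le_posLeft
    refine absurd ht.symm (h.star_ne hw.inverse e (fun _ => rfl) ?_ (OrderDual.toDual s)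
      (OrderDual.toDual t) hs)
    refine ⟨?_⟩
    rintro _ ⟨a, rfl⟩ _ ⟨b, rfl⟩ x ⟨_, hx⟩
    rcases exists_pos x with ⟨c, rfl⟩ | ⟨c, rfl⟩
    · exact ⟨OrderDual.toDual c, rfl⟩
    · exact absurd hx (posLeft_lt_posRight _ c).not_ge
  · exact ⟨t, ht.symm⟩

theorem IsCancellation.exists_star_posRight (h : (w.inverse.append v).IsCancellation T star)
    (hv : v.IsReduced) {s : v.S} (hs : posRight w v s ∈ T) :
    ∃ t, star (posRight w v s) = posLeft w v t := by
  rcases exists_pos (star (posRight w v s)) with ⟨t, ht⟩ | ⟨t, ht⟩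
  · exact ⟨t, ht.symm⟩
  · let e : v.S ↪o (w.inverse.append v).S :=
      OrderEmbedding.ofMapLEIff (posRight w v) fun a b => posRight_le_posRight
    refine absurd ht.symm (h.star_ne hv e (fun _ => rfl) ?_ s t hs)
    refine ⟨?_⟩
    rintro _ ⟨a, rfl⟩ _ ⟨b, rfl⟩ x ⟨hx, _⟩
    rcases exists_pos x with ⟨c, rfl⟩ | ⟨c, rfl⟩
    · exact absurd hx (posLeft_lt_posRight c _).not_ge
    · exact ⟨c, rfl⟩

/-- The order of `w` is reversed in `w⁻¹ v`, so smaller positions are closer to the junction. They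
lie in the interval spanned by a straddling pair and are cancelled by completeness. -/
theorem IsCancellation.isLowerSet_left (h : (w.inverse.append v).IsCancellation T star)
    (hw : w.IsReduced) : IsLowerSet (posLeft w v ⁻¹' T) := by
  intro s s' hs' hs
  obtain ⟨t, ht⟩ := h.exists_star_posLeft hw hs
  exact (h.between hs (posLeft_le_posLeft.2 hs') (by rw [ht]; exact (posLeft_lt_posRight _ _).le)).1

theorem IsCancellation.isLowerSet_right (h : (w.inverse.append v).IsCancellation T star)
    (hv : v.IsReduced) : IsLowerSet (posRight w v ⁻¹' T) := by
  intro s s' hs' hs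
  obtain ⟨t, ht⟩ := h.exists_star_posRight hv hs
  refine (h.between (h.mapsTo _ hs) (s := posRight w v s') ?_ ?_).1
  · rw [ht]; exact (posLeft_lt_posRight _ _).le
  · rw [h.invol _ hs]; exact posRight_le_posRight.2 hs'

/-- For reduced words `w` and `v`, a cancellation of `w⁻¹ v` identifies an initial segment of `w`
with an initial segment of `v`. -/
theorem IsCancellation.restrict_iso (h : (w.inverse.append v).IsCancellation T star)
    (hw : w.IsReduced) (hv : v.IsReduced) :
    (w.restrict (posLeft w v ⁻¹' T)).Iso (v.restrict (posRight w v ⁻¹' T)) := by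
  choose θ hθ using fun s : (w.restrict (posLeft w v ⁻¹' T)).S => h.exists_star_posLeft hw s.2
  let f : (w.restrict (posLeft w v ⁻¹' T)).S → (v.restrict (posRight w v ⁻¹' T)).S := fun s =>
    ⟨θ s, by rw [Set.mem_preimage, ← hθ]; exact h.mapsTo _ s.2⟩
  have hinj : Function.Injective f := fun s t hst => by
    have h1 : θ s = θ t := congrArg Subtype.val hst
    have h2 := hθ s
    rw [h1, ← hθ t] at h2
    have h3 := congrArg star h2
    rw [h.invol _ s.2, h.invol _ t.2] at h3
    exact Subtype.ext (posLeft_injective h3)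
  -- Pairs across the junction are nested, and reversing `w` turns nesting into preservation of
  -- order.
  have hmono : Monotone f := fun s t hst => by
    have h1 := (h.between t.2 (posLeft_le_posLeft.2 hst)
      (by rw [hθ]; exact (posLeft_lt_posRight _ _).le)).2.2
    rw [hθ, hθ] at h1
    have h2 : θ s ≤ θ t := posRight_le_posRight.1 h1
    exact h2
  have hsurj : Function.Surjective f := fun t => by
    obtain ⟨s, hs⟩ := h.exists_star_posRight hv t.2
    have hs' : posLeft w v s ∈ T := by rw [← hs]; exact h.mapsTo _ t.2
    refine ⟨⟨s, hs'⟩, Subtype.ext (posRight_injective (w := w) ?_)⟩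
    change posRight w v (θ ⟨s, hs'⟩) = _
    rw [← hθ, ← hs, h.invol _ t.2]
  refine ⟨(hmono.strictMono_of_injective hinj).orderIsoOfSurjective f hsurj, fun s => ?_⟩
  have h1 := h.inverse _ s.2
  rw [hθ] at h1
  have h2 : v.letter (θ s) = (w.letter s.1).inv.inv := h1
  rw [Letter.inv_inv] at h2
  exact h2

theorem restrict_compl_iso (T : Set (w.inverse.append v).S) :
    ((w.restrict (posLeft w v ⁻¹' T)ᶜ).inverse.append (v.restrict (posRight w v ⁻¹' T)ᶜ)).Iso
      ((w.inverse.append v).restrict Tᶜ) := by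
  let f : ((w.restrict (posLeft w v ⁻¹' T)ᶜ).inverse.append
      (v.restrict (posRight w v ⁻¹' T)ᶜ)).S → ((w.inverse.append v).restrict Tᶜ).S := fun s =>
    match s with
    | Sum.inl a => ⟨posLeft w v (OrderDual.ofDual a).1, (OrderDual.ofDual a).2⟩
    | Sum.inr b => ⟨posRight w v b.1, b.2⟩
  have hf : StrictMono f := by
    rintro (a | a) (b | b) h
    · have h1 : a < b := Sum.Lex.inl_lt_inl_iff.1 h
      exact Sum.Lex.inl_lt_inl_iff.2 h1
    · exact posLeft_lt_posRight _ _
    · exact (Sum.Lex.not_inr_lt_inl h).elim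
    · have h1 : a < b := Sum.Lex.inr_lt_inr_iff.1 h
      exact Sum.Lex.inr_lt_inr_iff.2 h1
  have hs : Function.Surjective f := by
    rintro ⟨x, hx⟩
    rcases exists_pos x with ⟨s, rfl⟩ | ⟨s, rfl⟩
    · exact ⟨toLex (Sum.inl (OrderDual.toDual ⟨s, hx⟩)), rfl⟩
    · exact ⟨toLex (Sum.inr ⟨s, hx⟩), rfl⟩
  refine ⟨hf.orderIsoOfSurjective f hs, ?_⟩
  rintro (s | s) <;> rfl

end InverseAppend

end Word

end BigFree

namespace BigFree

/-! ### The big free group: unique reduced words and the length function. -/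

namespace BF

variable {A : Type u}

theorem mk_eq_of_arises {w v : Word A} (h : Word.Arises w v) : mk w = mk v :=
  Quotient.sound (Relation.EqvGen.rel _ _ h)

theorem mk_eq_of_iso {w v : Word A} (h : w.Iso v) : mk w = mk v :=
  mk_eq_of_arises (.of_iso h)

theorem exists_isReduced_mk_eq (g : BF A) : ∃ w : Word A, w.IsReduced ∧ mk w = g := by
  induction g using Quotient.inductionOn with | _ w
  obtain ⟨T, star, h, hr⟩ := w.exists_isReduced_restrict
  exact ⟨_, hr, (mk_eq_of_arises h.arises_restrict).symm⟩

theorem proj_eq_of_mk_eq {w v : Word A} (h : mk w = mk v) (F : Finset A) :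
    Word.proj F w = Word.proj F v :=
  Word.proj_eq_of_eqv (Quotient.exact h) F

theorem exists_isCancellation_univ_of_mk_eq_one {w : Word A} (h : mk w = 1) :
    ∃ star, w.IsCancellation Set.univ star :=
  w.exists_isCancellation_univ fun F =>
    (proj_eq_of_mk_eq (h.trans mk_empty.symm) F).trans (Word.proj_empty F)

/-- A reduced word is determined by the element which it represents. -/
theorem iso_of_mk_eq {w v : Word A} (hw : w.IsReduced) (hv : v.IsReduced) (h : mk w = mk v) :
    w.Iso v := by
  -- The word `w⁻¹ v` cancels completely, so the initial segments matched by the cancellation are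
  -- all of `w` and all of `v`.
  obtain ⟨star, hs⟩ := exists_isCancellation_univ_of_mk_eq_one (w := w.inverse.append v)
    (by rw [← mk_mul, ← mk_inv, h, inv_mul_cancel])
  obtain ⟨e, he⟩ := hs.restrict_iso hw hv
  exact ⟨OrderIso.Set.univ.symm.trans (e.trans OrderIso.Set.univ), fun s => he ⟨s, trivial⟩⟩

theorem reducedWord_spec (g : BF A) : (reducedWord g).IsReduced ∧ mk (reducedWord g) = g := by
  have h := exists_isReduced_mk_eq g
  rw [reducedWord, dif_pos h]
  exact h.choose_spec

theorem length_mk {w : Word A} (hw : w.IsReduced) :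
    length (mk w) = toLex fun a => (w.count a : ℤ) := by
  rw [length]
  congr 1
  funext a
  obtain ⟨h1, h2⟩ := reducedWord_spec (mk w)
  rw [(iso_of_mk_eq h1 hw h2).count_eq]

theorem length_inv (g : BF A) : length g⁻¹ = length g := by
  obtain ⟨w, hw, rfl⟩ := exists_isReduced_mk_eq g
  rw [mk_inv, length_mk hw, length_mk hw.inverse]
  rfl

theorem length_eq_zero_iff (g : BF A) : length g = 0 ↔ g = 1 := by
  obtain ⟨w, hw, rfl⟩ := exists_isReduced_mk_eq g
  constructor
  · intro h
    rw [length_mk hw] at h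
    have := Word.isEmpty_of_count_eq_zero (w := w) fun a =>
      Int.natCast_eq_zero.1 (congrFun h a)
    exact mk_eq_of_iso w.iso_empty
  · intro h
    have h1 := iso_of_mk_eq hw Word.isReduced_empty (h.trans mk_empty.symm)
    rw [length_mk hw]
    funext a
    change (w.count a : ℤ) = 0
    rw [h1.count_eq]
    have : IsEmpty (Word.empty A).S := inferInstanceAs (IsEmpty PEmpty)
    rw [Word.count, Set.eq_empty_of_isEmpty {s : (Word.empty A).S | _}, Set.ncard_empty]
    rfl

/-- Free groups are torsion-free, so all projections of `g` are trivial. Its reduced word then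
cancels completely and is empty. -/
theorem eq_one_of_mul_self_eq_one (g : BF A) (h : g * g = 1) : g = 1 := by
  obtain ⟨w, hw, rfl⟩ := exists_isReduced_mk_eq g
  rw [mk_mul, ← mk_empty] at h
  obtain ⟨star, hs⟩ := w.exists_isCancellation_univ fun F => by
    have h1 := proj_eq_of_mk_eq h F
    rw [Word.proj_append, Word.proj_empty, ← sq] at h1
    exact (pow_eq_one_iff_left two_ne_zero).1 h1
  have := Set.univ_eq_empty_iff.1 (hw _ _ hs)
  exact mk_eq_of_iso w.iso_empty

theorem mk_restrict_mul (w : Word A) {I : Set w.S} (hI : IsLowerSet I) :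
    mk (w.restrict I) * mk (w.restrict Iᶜ) = mk w :=
  mk_eq_of_iso (w.restrict_append_iso hI)

/-- An initial segment of a reduced word represents a prefix. -/
theorem isPrefix_mk_restrict {w : Word A} (hw : w.IsReduced) {I : Set w.S} (hI : IsLowerSet I) :
    IsPrefix length (mk (w.restrict I)) (mk w) := by
  rw [IsPrefix, ← mk_restrict_mul w hI, inv_mul_cancel_left, mk_restrict_mul w hI, length_mk hw,
    length_mk (hw.restrict hI.ordConnected), length_mk (hw.restrict hI.compl.ordConnected),
    ← toLex_add]
  congr 1
  funext a
  rw [← (w.restrict_append_iso hI).count_eq, Word.count_append]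
  push_cast
  rfl

theorem isPrefix_mk_restrict_of_subset {w : Word A} (hw : w.IsReduced) {I J : Set w.S}
    (hI : IsLowerSet I) (hJ : IsLowerSet J) (h : I ⊆ J) :
    IsPrefix length (mk (w.restrict I)) (mk (w.restrict J)) := by
  rw [← mk_eq_of_iso (w.restrict_restrict_iso h)]
  exact isPrefix_mk_restrict (hw.restrict hJ.ordConnected) fun a b hab hb => hI hab hb

/-- Reduced words `w` and `v` have a common initial segment such that nothing else cancels in
`w⁻¹ v`. -/
theorem exists_common_prefix {w v : Word A} (hw : w.IsReduced) (hv : v.IsReduced) :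
    ∃ (I : Set w.S) (J : Set v.S), IsLowerSet I ∧ IsLowerSet J ∧
      mk (w.restrict I) = mk (v.restrict J) ∧
      length ((mk w)⁻¹ * mk v) =
        length ((mk (w.restrict I))⁻¹ * mk w) + length ((mk (w.restrict I))⁻¹ * mk v) := by
  -- Because this cancellation leaves a reduced word, counting letters in what remains of `w` and of
  -- `v` computes the length of the product.
  obtain ⟨T, star, h, hr⟩ := (w.inverse.append v).exists_isReduced_restrict
  have hI := h.isLowerSet_left hw
  have hJ := h.isLowerSet_right hv
  have hIJ := mk_eq_of_iso (h.restrict_iso hw hv)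
  refine ⟨_, _, hI, hJ, hIJ, ?_⟩
  have e1 : (mk w)⁻¹ * mk v = mk ((w.inverse.append v).restrict Tᶜ) := by
    rw [mk_inv, mk_mul]
    exact mk_eq_of_arises h.arises_restrict
  have e2 : (mk (w.restrict (w.posLeft v ⁻¹' T)))⁻¹ * mk v =
      mk (v.restrict (w.posRight v ⁻¹' T)ᶜ) := by
    rw [hIJ, ← mk_restrict_mul v hJ, inv_mul_cancel_left]
  have e3 : (mk (w.restrict (w.posLeft v ⁻¹' T)))⁻¹ * mk w =
      mk (w.restrict (w.posLeft v ⁻¹' T)ᶜ) := by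
    rw [← mk_restrict_mul w hI, inv_mul_cancel_left]
  rw [e1, e2, e3, length_mk hr, length_mk (hw.restrict hI.compl.ordConnected),
    length_mk (hv.restrict hJ.compl.ordConnected), ← toLex_add]
  congr 1
  funext a
  rw [← (Word.restrict_compl_iso T).count_eq, Word.count_append, Word.count_inverse]
  push_cast
  rfl

theorem exists_isPrefix (g h : BF A) : ∃ p, IsPrefix length p g ∧ IsPrefix length p h ∧
    length (g⁻¹ * h) = length (p⁻¹ * g) + length (p⁻¹ * h) := by
  obtain ⟨w, hw, rfl⟩ := exists_isReduced_mk_eq g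
  obtain ⟨v, hv, rfl⟩ := exists_isReduced_mk_eq h
  obtain ⟨I, J, hI, hJ, hIJ, he⟩ := exists_common_prefix hw hv
  exact ⟨_, isPrefix_mk_restrict hw hI, hIJ ▸ isPrefix_mk_restrict hv hJ, he⟩

/-- The product `c(g, h)` is the length of the common prefix, hence lies in `ℤ^A`. -/
theorem exists_add_self_eq_twiceC (g h : BF A) : ∃ c, c + c = twiceC length g h := by
  obtain ⟨p, h1, h2, h3⟩ := exists_isPrefix g h
  rw [IsPrefix] at h1 h2
  refine ⟨length p, ?_⟩
  rw [twiceC, h1, h2, h3]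
  abel

variable [LinearOrder A] [WellFoundedLT A]

theorem length_nonneg (g : BF A) : 0 ≤ length g :=
  Pi.toLex_monotone (a := (0 : A → ℤ)) fun _ => Int.natCast_nonneg _

theorem length_le_add (g h : BF A) : length (g⁻¹ * h) ≤ length g + length h := by
  obtain ⟨p, h1, h2, h3⟩ := exists_isPrefix g h
  rw [IsPrefix] at h1 h2
  rw [h1, h2, h3]
  exact add_le_add (le_add_of_nonneg_left (length_nonneg p))
    (le_add_of_nonneg_left (length_nonneg p))

theorem isLengthFunction_length : IsLengthFunction (length (A := A)) where
  eq_zero_iff := length_eq_zero_iff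
  inv g := (length_inv g).symm
  hyp g h k := by
    obtain ⟨w, hw, rfl⟩ := exists_isReduced_mk_eq k
    obtain ⟨u, hu, rfl⟩ := exists_isReduced_mk_eq g
    obtain ⟨v, hv, rfl⟩ := exists_isReduced_mk_eq h
    obtain ⟨I, I', hI, hI', hp, hp'⟩ := exists_common_prefix hw hu
    obtain ⟨J, J', hJ, hJ', hq, hq'⟩ := exists_common_prefix hw hv
    have p1 := isPrefix_mk_restrict hw hI
    have p2 : IsPrefix length (mk (w.restrict I)) (mk u) := hp ▸ isPrefix_mk_restrict hu hI'
    have q1 := isPrefix_mk_restrict hw hJ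
    have q2 : IsPrefix length (mk (w.restrict J)) (mk v) := hq ▸ isPrefix_mk_restrict hv hJ'
    have e1 : twiceC length (mk u) (mk w) =
        length (mk (w.restrict I)) + length (mk (w.restrict I)) := by
      rw [IsPrefix] at p1 p2
      rw [twiceC, ← length_inv (_ * _), mul_inv_rev, inv_inv, hp', p1, p2]
      abel
    have e2 : twiceC length (mk v) (mk w) =
        length (mk (w.restrict J)) + length (mk (w.restrict J)) := by
      rw [IsPrefix] at q1 q2
      rw [twiceC, ← length_inv (_ * _), mul_inv_rev, inv_inv, hq', q1, q2]
      abel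
    -- The common prefixes of `k` with `g` and of `k` with `h` are initial segments of one reduced
    -- word, so one contains the other. The smaller is a prefix of both `g` and `h` and bounds `c(g,
    -- h)` from below.
    rcases hI.total hJ with hIJ | hIJ
    · refine (min_le_left _ _).trans (e1.trans_le (p2.add_self_le_twiceC length_le_add ?_))
      exact (isPrefix_mk_restrict_of_subset hw hI hJ hIJ).trans length_inv length_le_add q2
    · refine (min_le_right _ _).trans (e2.trans_le (IsPrefix.add_self_le_twiceC length_le_add ?_ q2))
      exact (isPrefix_mk_restrict_of_subset hw hJ hI hIJ).trans length_inv length_le_add p2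

theorem eq_one_of_smul_eq {h : BF A} {x : Tree (isLengthFunction_length (A := A))}
    (hx : h • x = x) : h = 1 :=
  isLengthFunction_length.eq_one_of_length_sq_le exists_isPrefix eq_one_of_mul_self_eq_one
    (Tree.length_sq_le_of_smul_eq _ hx)

end BF

end BigFree

theorem mainTheorem1 {A : Type u} [LinearOrder A] [WellFoundedLT A] :
    (∀ g : BigFree.BF A, ∃ w : BigFree.Word A, w.IsReduced ∧ BigFree.BF.mk w = g ∧
      ∀ v : BigFree.Word A, v.IsReduced → BigFree.BF.mk v = g → w.Iso v) ∧
    BigFree.IsLambdaMetric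
      (fun w v : BigFree.BF A => BigFree.BF.length (w⁻¹ * v)) ∧
    BigFree.IsHyperbolic
      (fun w v : BigFree.BF A => BigFree.BF.length (w⁻¹ * v)) 0 ∧
    BigFree.GromovIntegral
      (fun w v : BigFree.BF A => BigFree.BF.length (w⁻¹ * v)) ∧
    ∃ hL : BigFree.IsLengthFunction (BigFree.BF.length (A := A)),
      BigFree.IsLambdaTree (BigFree.Tree.dist hL) ∧
      (∀ w v : BigFree.BF A,
        BigFree.Tree.dist hL (BigFree.Tree.ofGroup hL w) (BigFree.Tree.ofGroup hL v) =
          BigFree.BF.length (w⁻¹ * v)) ∧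
      (∀ (h g : BigFree.BF A) (n : Lex (A → ℤ)) (h0 : 0 ≤ n) (h1 : n ≤ BigFree.BF.length g),
        BigFree.Tree.dist hL (BigFree.Tree.ofGroup hL h)
            (h • BigFree.Tree.point hL n g h0 h1) = n ∧
          ∃ s : Set (BigFree.Tree hL),
            BigFree.IsSegmentBetween (BigFree.Tree.dist hL) (BigFree.Tree.ofGroup hL h)
              (BigFree.Tree.ofGroup hL (h * g)) s ∧
            h • BigFree.Tree.point hL n g h0 h1 ∈ s) ∧
      (∀ (h : BigFree.BF A) (x y : BigFree.Tree hL),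
        BigFree.Tree.dist hL (h • x) (h • y) = BigFree.Tree.dist hL x y) ∧
      (∀ (h : BigFree.BF A) (x : BigFree.Tree hL), h • x = x → h = 1) ∧
      (∀ h : BigFree.BF A, (∃ x : BigFree.Tree hL, h • h • x = x) →
        ∃ x : BigFree.Tree hL, h • x = x) := by
  have hL := BigFree.BF.isLengthFunction_length (A := A)
  have hm := BigFree.Tree.isLambdaMetric_dist hL
  have hh := BigFree.Tree.isHyperbolic_dist hL
  have hi := BigFree.Tree.gromovIntegral_dist hL BigFree.BF.exists_add_self_eq_twiceC
  -- The metric of the group is the restriction of the tree metric, so the triangle inequality,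
  -- hyperbolicity and integrality are inherited.
  have hd : (fun w v : BigFree.BF A => BigFree.BF.length (w⁻¹ * v)) = fun w v =>
      BigFree.Tree.dist hL (BigFree.Tree.ofGroup hL w) (BigFree.Tree.ofGroup hL v) := by
    funext w v
    rw [BigFree.Tree.dist_ofGroup]
  refine ⟨fun g => ?_, ⟨fun w v => ?_, fun w v => ?_, fun w v => ?_, fun w v x => ?_⟩, ?_, ?_,
    hL, BigFree.Tree.isLambdaTree_dist hL BigFree.BF.exists_add_self_eq_twiceC,
    BigFree.Tree.dist_ofGroup hL, fun h g n h0 h1 => ⟨?_, ?_⟩, BigFree.Tree.dist_smul_smul hL,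
    fun h x => BigFree.BF.eq_one_of_smul_eq, fun h ⟨x, hx⟩ => ⟨x, ?_⟩⟩
  · obtain ⟨w, hw, rfl⟩ := BigFree.BF.exists_isReduced_mk_eq g
    exact ⟨w, hw, rfl, fun v hv h => BigFree.BF.iso_of_mk_eq hw hv h.symm⟩
  · exact hL.nonneg _
  · rw [hL.eq_zero_iff, inv_mul_eq_one]
  · rw [hL.inv, mul_inv_rev, inv_inv]
  · simp only [← BigFree.Tree.dist_ofGroup hL]
    exact hm.triangle _ _ _
  · rw [hd]
    exact fun _ _ _ _ => hh _ _ _ _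
  · rw [hd]
    exact fun _ _ _ => hi _ _ _
  · have h2 := BigFree.Tree.dist_smul_ofGroup hL h 1 (BigFree.Tree.point hL n g h0 h1)
    rwa [mul_one, hm.symm, hm.symm _ (BigFree.Tree.ofGroup hL 1),
      BigFree.Tree.dist_one_point] at h2
  · refine ⟨_, BigFree.isSegmentBetween_between hm hh
      (BigFree.Tree.hasIntermediate_dist hL BigFree.BF.exists_add_self_eq_twiceC) _ _, ?_⟩
    have h2 := BigFree.Tree.smul_mem_between hL h _ _ (BigFree.Tree.point_mem_between hL n g h0 h1)
    rwa [mul_one] at h2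
  -- Freeness gives `h * h = 1`; without `2`-torsion `h = 1`, so there are no inversions.
  · have h1 : h * h = 1 := BigFree.BF.eq_one_of_smul_eq (x := x) (by rwa [mul_smul])
    rw [BigFree.BF.eq_one_of_mul_self_eq_one h h1, one_smul]
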